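/- Let $p$ be a prime, $m\ge 1$ and $s\ge 1$ integers, $N=p^m$, and let $f\in\mathbb F_p[x]$ be irreducible with $\deg f=m$. Let $(\gamma_j)_{j\ge1}$ be a non-increasing sequence of real numbers with $0<\gamma_j\le 1$, put $\gamma_{\mathfrak u}=\prod_{j\in\mathfrak u}\gamma_j$ for $\mathfrak u\subseteq[s]=\{1,\dots,s\}$, and let $(w_j)_{j\ge1}$ be a non-decreasing sequence of nonnegative integers. *Point set and discrepancy.* Identify $\mathbb F_p$ with $\{0,\dots,p-1\}$ and, for a Laurent series over $\mathbb F_p$ in $x^{-1}$, set $\phi_m\bigl(\sum_{l\ge\omega}t_lx^{-l}\bigr)=\sum_{l=\max\{1,\omega\}}^m t_lp^{-l}$. For $0\le n<p^m$ with base-$p$ expansion $n=\sum_{r<m}n_rp^r$ let $n(x)=\sum_{r<m}n_rx^r$. For $\boldsymbol q=(q_1,\dots,q_s)\in\mathbb F_p[x]^s$ the polynomial lattice point set $\mathcal P(\boldsymbol q,f)$ consists of the $N$ points (counted with multiplicity) $\boldsymbol x_n=\bigl(\phi_m(n(x)q_1/f),\dots,\phi_m(n(x)q_s/f)\bigr)$,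 $0\le n<N$. Its weighted star discrepancy is $$D^*_{N,\boldsymbol\gamma}(\boldsymbol q,f)=\sup_{\boldsymbol t\in(0,1]^s}\ \max_{\emptyset\ne\mathfrak u\subseteq[s]}\gamma_{\mathfrak u}\,\bigl|\Delta((\boldsymbol t_{\mathfrak u},\boldsymbol 1))\bigr|,\qquad \Delta(\boldsymbol t)=\frac1N\#\Bigl\{n:\boldsymbol x_n\in\prod_{j=1}^s[0,t_j)\Bigr\}-\prod_{j=1}^st_j,$$ where $(\boldsymbol t_{\mathfrak u},\boldsymbol 1)$ has $j$th coordinate $t_j$ if $j\in\mathfrak u$ and $1$ otherwise. *Construction.* Let $G_{p,m}$ be the set of polynomials over $\mathbb F_p$ of degree $<m$. For nonzero $h=h_0+\dots+h_ax^a$ with $h_a\ne0$ let $r_p(h)=p^{-a-1}\sin^{-2}(\pi h_a/p)$, and let $r_p(0,\gamma)=1+\gamma$ and $r_p(h,\gamma)=\gamma\, r_p(h)$ for $h\neq 0$. For $\boldsymbol q\in\mathbb F_p[x]^d$ let $$R^d_{\boldsymbol\gamma}(\boldsymbol q,f)=\sum_{\substack{\boldsymbol h\in G_{p,m}^d\setminus\{\boldsymbol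 0\}\\ h_1q_1+\dots+h_dq_d\equiv0\ (\mathrm{mod}\ f)}}\ \prod_{i=1}^dr_p(h_i,\gamma_i).$$ For $w<m$ let $\mathcal G_{p,m-w}(f)$ be the set of polynomials of degree $<m-w$ that are coprime to $f$, and for $w\ge m$ let $\mathcal G_{p,m-w}(f)=\{1\}$. Let $(g_1,\dots,g_s)$ with $g_i\in\mathcal G_{p,m-w_i}(f)$ be any vector constructed by the reduced component-by-component algorithm, that is, $g_1=1$ and, for $d=1,\dots,s-1$, $g_{d+1}$ minimizes $q\mapsto R^{d+1}_{\boldsymbol\gamma}\bigl((x^{w_1}g_1,\dots,x^{w_d}g_d,x^{w_{d+1}}q),f\bigr)$ over $q\in\mathcal G_{p,m-w_{d+1}}(f)$. Then $$D^*_{N,\boldsymbol\gamma}\bigl((x^{w_1}g_1,\dots,x^{w_s}g_s),f\bigr)\le\sum_{\emptyset\ne\mathfrak u\subseteq[s]}\gamma_{\mathfrak u}\Bigl(1-\Bigl(1-\frac1N\Bigr)^{|\mathfrak u|}\Bigr)+\frac1N\prod_{i=1}^s\Bigl(1+\gamma_i+\gamma_i\,p^{\min\{w_i,m\}}\,m\,\frac{p+1}{3}\Bigr).$$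 -/

import Mathlib

open Polynomial

noncomputable section

namespace PolyLattice

/-! Coordinates are indexed by `Fin s = {0, …, s - 1}`; index `i` here is the coordinate usually
called `i + 1`. -/

/-! ### Weighted star discrepancy -/

/-- Product weights `γ_u = ∏_{j ∈ u} γ_j` (so `γ_∅ = 1`). -/
def prodWeight {s : ℕ} (γ : Fin s → ℝ) (u : Finset (Fin s)) : ℝ := ∏ j ∈ u, γ j

/-- The box `[0, t) = [0, t_1) × ⋯ × [0, t_s)`. -/
def box {s : ℕ} (t : Fin s → ℝ) : Set (Fin s → ℝ) :=
  Set.univ.pi fun j => Set.Ico 0 (t j)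

/-- Local discrepancy at `t` of the points `x_0, …, x_{N-1}` (counted with multiplicity). -/
def localDisc {N s : ℕ} (x : Fin N → Fin s → ℝ) (t : Fin s → ℝ) : ℝ :=
  (1 / (N : ℝ)) * ∑ n, (box t).indicator (fun _ => (1 : ℝ)) (x n) - ∏ j, t j

/-- The vector `(t_u, 1)`. -/
def fillOne {s : ℕ} (u : Finset (Fin s)) (t : Fin s → ℝ) : Fin s → ℝ :=
  fun j => if j ∈ u then t j else 1

/-- Weighted star discrepancy: the supremum over `t ∈ (0, 1]^s` of the maximum over nonempty
`u ⊆ [s]` of `γ_u |Δ((t_u, 1), P)|`. The supremum is over a bounded set, because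
`|Δ| ≤ 1` on `(0, 1]^s`. -/
def weightedStarDisc {N s : ℕ} (γ : Finset (Fin s) → ℝ) (x : Fin N → Fin s → ℝ) : ℝ :=
  ⨆ t : Set.univ.pi (fun _ : Fin s => Set.Ioc (0 : ℝ) 1),
    ⨆ u : {u : Finset (Fin s) // u.Nonempty}, γ u.1 * |localDisc x (fillOne u.1 t.1)|

/-! ### Polynomial lattice point sets -/

/-- The embedding of `𝔽_p[x]` in `𝔽_p((x⁻¹))`. An element of `LaurentSeries (ZMod p)` is read as a
Laurent series in the variable `x⁻¹`, that is, its coefficient at `l` is the coefficient of `x^{-l}`;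
hence `x` is `single (-1) 1`. -/
def toLaurent (p : ℕ) [Fact p.Prime] : (ZMod p)[X] →ₐ[ZMod p] LaurentSeries (ZMod p) :=
  aeval (HahnSeries.single (-1 : ℤ) (1 : ZMod p))

/-- `φ_m (∑_l t_l x^{-l}) = ∑_{l=1}^m t_l p^{-l}`, with `t_l` read in `{0, …, p - 1}`. -/
def phi (p : ℕ) [Fact p.Prime] (m : ℕ) (L : LaurentSeries (ZMod p)) : ℝ :=
  ∑ l ∈ Finset.Icc 1 m, ((L.coeff (l : ℤ)).val : ℝ) / (p : ℝ) ^ l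

/-- The polynomial `n(x) = ∑_{r<m} n_r x^r`, where `n_r` are the base `p` digits of `n`. -/
def natPoly (p m n : ℕ) : (ZMod p)[X] :=
  ∑ r ∈ Finset.range m, C ((n / p ^ r % p : ℕ) : ZMod p) * X ^ r

/-- The `N = p^m` points of the polynomial lattice point set `P(g, f)`. -/
def latticePoint (p : ℕ) [Fact p.Prime] (m : ℕ) {s : ℕ} (g : Fin s → (ZMod p)[X])
    (f : (ZMod p)[X]) (n : Fin (p ^ m)) : Fin s → ℝ :=
  fun i => phi p m (toLaurent p (natPoly p m n * g i) / toLaurent p f)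

/-! ### The quantity `R` and the reduced component-by-component construction -/

/-- `G_{p,m}`, the polynomials of degree `< m`, is finite. -/
instance fintypeDegreeLT (p : ℕ) [Fact p.Prime] (m : ℕ) : Fintype (degreeLT (ZMod p) m) :=
  Fintype.ofEquiv (Fin m → ZMod p) (degreeLTEquiv (ZMod p) m).symm.toEquiv

/-- `r_p(h) = 1 / (p^{a+1} sin²(π h_a / p))` for `h ≠ 0` of degree `a` with leading coefficient
`h_a`. -/
def rho (p : ℕ) (h : (ZMod p)[X]) : ℝ :=
  1 / ((p : ℝ) ^ (h.natDegree + 1) *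
    Real.sin (Real.pi / p * (h.leadingCoeff.val : ℝ)) ^ 2)

open Classical in
/-- `r_p(h, γ)`: equal to `1 + γ` if `h = 0`, and to `γ r_p(h)` otherwise. -/
def rhoW (p : ℕ) (h : (ZMod p)[X]) (γ : ℝ) : ℝ :=
  if h = 0 then 1 + γ else γ * rho p h

open Classical in
/-- `R^d_γ(g, f)`: the sum of `∏ r_p(h_i, γ_i)` over nonzero `h ∈ G_{p,m}^d` with
`h · g ≡ 0 (mod f)`. -/
def R (p : ℕ) [Fact p.Prime] (m : ℕ) {d : ℕ} (γ : Fin d → ℝ) (g : Fin d → (ZMod p)[X])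
    (f : (ZMod p)[X]) : ℝ :=
  ∑ h : Fin d → degreeLT (ZMod p) m with
      h ≠ 0 ∧ f ∣ ∑ i, (h i : (ZMod p)[X]) * g i,
    ∏ i, rhoW p (h i : (ZMod p)[X]) (γ i)

/-- The reduced search set: polynomials of degree `< m - w` coprime to `f` if `w < m`, and `{1}` if
`w ≥ m`. -/
def searchSet (p m w : ℕ) (f : (ZMod p)[X]) : Set (ZMod p)[X] :=
  if w < m then {g | g.degree < ((m - w : ℕ) : WithBot ℕ) ∧ IsCoprime g f} else {1}

/-- The vector `(x^{w_1} g_1, …, x^{w_d} g_d, x^{w_{d+1}} q)` of length `d + 1`. -/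
def extendBy {p s : ℕ} (w : ℕ → ℕ) (g : Fin s → (ZMod p)[X]) (d : Fin s) (q : (ZMod p)[X]) :
    Fin (d.val + 1) → (ZMod p)[X] :=
  Fin.snoc (α := fun _ => (ZMod p)[X])
    (fun i : Fin d.val => X ^ w i.val * g (i.castLE d.isLt.le)) (X ^ w d.val * q)

/-- `g = (g_1, …, g_s)` is a possible output of the reduced component-by-component algorithm:
every component lies in its search set, the first component is `1`, and every later component
minimizes `R` over its search set, given the earlier components. -/
structure IsReducedCBC (p : ℕ) [Fact p.Prime] (m : ℕ) {s : ℕ} (γ : ℕ → ℝ) (w : ℕ → ℕ)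
    (f : (ZMod p)[X]) (g : Fin s → (ZMod p)[X]) : Prop where
  mem : ∀ i : Fin s, g i ∈ searchSet p m (w i.val) f
  first : ∀ i : Fin s, i.val = 0 → g i = 1
  step : ∀ d : Fin s, d.val ≠ 0 → ∀ q ∈ searchSet p m (w d.val) f,
    R p m (fun i : Fin (d.val + 1) => γ i.val) (extendBy w g d (g d)) f ≤
      R p m (fun i : Fin (d.val + 1) => γ i.val) (extendBy w g d q) f

end PolyLattice

end

noncomputable section

namespace PolyLattice

/-! ### Character sums over digit vectors -/

/-! The proof bounds the discrepancy by rounding errors plus `R`, then bounds `R` by averaging over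
each search set.

Discrepancy. All coordinates are multiples of `1/N`, so a box holds the same points after each side
is rounded up to a multiple of `1/N`. This changes the volume by at most `1 - (1 - 1/N)^|u|`
(`prod_sub_prod_le`). The indicator of a rounded side is expanded in Walsh functions, the characters
of the digit vector, indexed by polynomials `h` of degree `< m`. A product of such characters sums
to zero over the lattice unless `f ∣ h · q` (`sum_stdAddChar_lattice`), and `h = 0` gives the
volume. What remains is a sum of products of Walsh coefficients over the nonzero `h` that enter `R`.
Each coefficient at `h ≠ 0` is at most `rho p h` (`norm_walshCoeff_le`) and vanishes on a full side
(`walshCoeff_full`). With the weights inserted, `R` is an upper bound for every `u`, so it is paid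
only once.

Bound on `R`. Splitting off the last coordinate gives `(1 + γ) R^d` plus `lastPart`, and only the
latter depends on the new component. A minimum is at most an average. For `w < m`, each congruence
has at most one solution among the `p^(m-w) - 1` candidates, so the average is controlled by the
unrestricted sum of weights. That sum is explicit: Parseval evaluates the sum of squared cosecants
(`sum_one_div_sin_sq`), whence `m (p² - 1) / (3p)`. -/

theorem stdAddChar_sum {p : ℕ} [NeZero p] {ι : Type*} (s : Finset ι) (e : ι → ZMod p) :
    (ZMod.stdAddChar (∑ i ∈ s, e i) : ℂ) = ∏ i ∈ s, ZMod.stdAddChar (e i) := by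
  classical
  induction s using Finset.induction_on with
  | empty => simp
  | insert a s ha ih => rw [Finset.sum_insert ha, Finset.prod_insert ha, AddChar.map_add_eq_mul, ih]

theorem sum_stdAddChar_dot (p : ℕ) [Fact p.Prime] {m : ℕ} (e : Fin m → ZMod p) :
    ∑ c : Fin m → ZMod p, (ZMod.stdAddChar (∑ i, c i * e i) : ℂ) =
      if e = 0 then (p : ℂ) ^ m else 0 := by
  simp_rw [stdAddChar_sum]
  rw [← Fintype.piFinset_univ, ←
    Finset.prod_univ_sum (fun _ : Fin m => (Finset.univ : Finset (ZMod p)))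
    (fun i c => (ZMod.stdAddChar (c * e i) : ℂ))]
  simp_rw [AddChar.sum_mulShift _ (ZMod.isPrimitive_stdAddChar p)]
  split_ifs with h
  · simp [h, ZMod.card]
  · obtain ⟨i, hi⟩ := Function.ne_iff.mp h
    exact Finset.prod_eq_zero (Finset.mem_univ i) (by
      rw [if_neg (by simpa using hi), Nat.cast_zero])

theorem sum_degreeLT_stdAddChar (p : ℕ) [Fact p.Prime] {m : ℕ} (e : Fin m → ZMod p) :
    ∑ h : degreeLT (ZMod p) m,
        (ZMod.stdAddChar (∑ i : Fin m, (h : (ZMod p)[X]).coeff i * e i) : ℂ) =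
      if e = 0 then (p : ℂ) ^ m else 0 := by
  rw [← sum_stdAddChar_dot p e]
  exact Fintype.sum_equiv (degreeLTEquiv (ZMod p) m).toEquiv _ _ fun h => rfl

/-- Base `p` digits, least significant first, as a bijection. -/
def digitEquiv (p : ℕ) [Fact p.Prime] (m : ℕ) : Fin (p ^ m) ≃ (Fin m → ZMod p) :=
  finFunctionFinEquiv.symm.trans (Equiv.arrowCongr (Equiv.refl _) (ZMod.finEquiv p).toEquiv)

theorem finEquiv_apply (p : ℕ) [NeZero p] (x : Fin p) : ZMod.finEquiv p x = ((x : ℕ) : ZMod p) := by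
  obtain ⟨n, rfl⟩ := Nat.exists_eq_succ_of_ne_zero (NeZero.ne p)
  exact (Fin.cast_val_eq_self x).symm

theorem digitEquiv_apply (p : ℕ) [Fact p.Prime] (m : ℕ) (n : Fin (p ^ m)) (r : Fin m) :
    digitEquiv p m n r = ((n / p ^ (r : ℕ) : ℕ) : ZMod p) := by
  have : digitEquiv p m n r = ZMod.finEquiv p (finFunctionFinEquiv.symm n r) := rfl
  rw [this, finEquiv_apply, finFunctionFinEquiv_symm_apply_val, ZMod.natCast_mod]

theorem digitEquiv_symm_val (p : ℕ) [Fact p.Prime] (m : ℕ) (c : Fin m → ZMod p) :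
    ((digitEquiv p m).symm c : ℕ) = ∑ i, (c i).val * p ^ (i : ℕ) := by
  have hval : ∀ x : ZMod p, ((ZMod.finEquiv p).symm x : ℕ) = x.val := fun x => by
    obtain ⟨y, rfl⟩ := (ZMod.finEquiv p).surjective x
    rw [RingEquiv.symm_apply_apply, finEquiv_apply, ZMod.val_cast_of_lt y.2]
  have : (digitEquiv p m).symm c =
      finFunctionFinEquiv fun i => (ZMod.finEquiv p).symm (c i) := rfl
  rw [this, finFunctionFinEquiv_apply]
  simp_rw [hval]

theorem sum_fin_stdAddChar (p : ℕ) [Fact p.Prime] {m : ℕ} (e : Fin m → ZMod p) :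
    ∑ n : Fin (p ^ m),
        (ZMod.stdAddChar (∑ r : Fin m, ((n / p ^ (r : ℕ) : ℕ) : ZMod p) * e r) : ℂ) =
      if e = 0 then (p : ℂ) ^ m else 0 := by
  rw [← sum_stdAddChar_dot p e]
  refine Fintype.sum_equiv (digitEquiv p m) _ _ fun n => ?_
  simp_rw [digitEquiv_apply]

theorem eq_of_digits_eq (p : ℕ) [Fact p.Prime] {m x y : ℕ} (hx : x < p ^ m) (hy : y < p ^ m)
    (h : ∀ r < m, ((x / p ^ r : ℕ) : ZMod p) = ((y / p ^ r : ℕ) : ZMod p)) : x = y := by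
  have : digitEquiv p m ⟨x, hx⟩ = digitEquiv p m ⟨y, hy⟩ := by
    ext r
    simp only [digitEquiv_apply]
    rw [h r r.2]
  simpa using (digitEquiv p m).injective this

/-! ### Sums over blocks of integers -/

theorem sum_range_mul_eq {A : Type*} [AddCommMonoid A] (G : ℕ → A) (K M : ℕ) :
    ∑ y ∈ Finset.range (K * M), G y =
      ∑ z ∈ Finset.range K, ∑ x ∈ Finset.range M, G (z * M + x) := by
  induction K with
  | zero => simp
  | succ K ih => rw [Nat.succ_mul, Finset.sum_range_add, ih, Finset.sum_range_succ]

theorem sum_range_pow_div {ζ : ℂ} {M : ℕ} (hM : 0 < M) (K ρ : ℕ) (hρ : ρ ≤ M) :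
    ∑ y ∈ Finset.range (K * M + ρ), ζ ^ (y / M) =
      M * ∑ z ∈ Finset.range K, ζ ^ z + ρ * ζ ^ K := by
  have key : ∀ z, ∀ x < M, (z * M + x) / M = z := fun z x hx => by
    rw [mul_comm, Nat.mul_add_div hM, Nat.div_eq_of_lt hx, add_zero]
  rw [Finset.sum_range_add, sum_range_mul_eq, Finset.mul_sum]
  congr 1
  · refine Finset.sum_congr rfl fun z _ => ?_
    rw [Finset.sum_congr rfl fun x hx => by rw [key z x (Finset.mem_range.mp hx)]]
    simp
  · rw [Finset.sum_congr rfl fun x hx => by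
      rw [key K x ((Finset.mem_range.mp hx).trans_le hρ)]]
    simp

/-- On a block of length `p * M` the factor `B` is constant, while `ζ ^ (y / M)` takes each value
`1, ζ, …, ζ^(p-1)` exactly `M` times. -/
theorem sum_range_blocks_eq_zero {ζ : ℂ} {p : ℕ} (hζ : ζ ^ p = 1) (hζ1 : ζ ≠ 1) {M : ℕ}
    (hM : 0 < M) (hp : 0 < p) (B : ℕ → ℂ) (q : ℕ) :
    ∑ y ∈ Finset.range (q * (p * M)), B (y / (p * M)) * ζ ^ (y / M) = 0 := by
  rw [sum_range_mul_eq]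
  refine Finset.sum_eq_zero fun z _ => ?_
  have h1 : ∀ x ∈ Finset.range (p * M),
      B ((z * (p * M) + x) / (p * M)) * ζ ^ ((z * (p * M) + x) / M) = B z * ζ ^ (x / M) := by
    intro x hx
    have e1 : (z * (p * M) + x) / (p * M) = z := by
      rw [mul_comm, Nat.mul_add_div (by positivity), Nat.div_eq_of_lt (Finset.mem_range.mp hx),
        add_zero]
    have e2 : (z * (p * M) + x) / M = p * z + x / M := by
      rw [show z * (p * M) + x = M * (p * z) + x by ring, Nat.mul_add_div hM]
    rw [e1, e2, pow_add, pow_mul, hζ, one_pow, one_mul]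
  rw [Finset.sum_congr rfl h1, ← Finset.mul_sum]
  have h2 := sum_range_pow_div (ζ := ζ) hM p 0 (Nat.zero_le _)
  have h3 : ∑ z ∈ Finset.range p, ζ ^ z = 0 := by
    have := mul_geom_sum ζ p
    rw [hζ, sub_self] at this
    exact (mul_eq_zero.mp this).resolve_left (sub_ne_zero.mpr hζ1)
  rw [add_zero] at h2
  rw [h2, h3]
  simp

/-- With `K = r / M` and `ρ = r % M`, the sum times `ζ - 1` telescopes to `(M - ρ)(ζ^K - 1) +
ρ(ζ^(K+1) - 1)`. The weights add up to `M`, so the bound is independent of `r`. -/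
theorem norm_sum_range_pow_div_le {ζ : ℂ} (hζ : ‖ζ‖ = 1) {M : ℕ} (hM : 0 < M) (r : ℕ) :
    ‖ζ - 1‖ * ‖∑ y ∈ Finset.range r, ζ ^ (y / M)‖ ≤ 2 * M := by
  have hρ : r % M ≤ M := (Nat.mod_lt _ hM).le
  have h := sum_range_pow_div (ζ := ζ) hM (r / M) (r % M) hρ
  rw [mul_comm (r / M), Nat.div_add_mod] at h
  rw [← norm_mul, h]
  have e : (ζ - 1) * (M * ∑ z ∈ Finset.range (r / M), ζ ^ z + ((r % M : ℕ) : ℂ) * ζ ^ (r / M)) =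
      ((M - r % M : ℕ) : ℂ) * (ζ ^ (r / M) - 1) + ((r % M : ℕ) : ℂ) * (ζ ^ (r / M + 1) - 1) := by
    have := mul_geom_sum ζ (r / M)
    rw [Nat.cast_sub hρ]
    linear_combination (M : ℂ) * this
  have hb : ∀ n, ‖ζ ^ n - 1‖ ≤ 2 := fun n => by
    refine (norm_sub_le _ _).trans ?_
    rw [norm_pow, hζ, one_pow, norm_one]; norm_num
  rw [e]
  refine (norm_add_le _ _).trans ?_
  rw [norm_mul, norm_mul, Complex.norm_natCast, Complex.norm_natCast]
  calc _ ≤ ((M - r % M : ℕ) : ℝ) * 2 + ((r % M : ℕ) : ℝ) * 2 := by gcongr <;> exact hb _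
    _ = 2 * M := by rw [Nat.cast_sub hρ]; ring

/-- Complete blocks cancel; on the incomplete last one `B` is a constant of norm at most `1`. -/
theorem norm_sum_range_blocks_le {ζ : ℂ} {p : ℕ} (hζ : ζ ^ p = 1) (hζ1 : ζ ≠ 1) {M : ℕ}
    (hM : 0 < M) (hp : 0 < p) (B : ℕ → ℂ) (hB : ∀ z, ‖B z‖ ≤ 1) (k : ℕ) :
    ‖ζ - 1‖ * ‖∑ y ∈ Finset.range k, B (y / (p * M)) * ζ ^ (y / M)‖ ≤ 2 * M := by
  have hnorm : ‖ζ‖ = 1 := Complex.norm_eq_one_of_pow_eq_one hζ hp.ne'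
  have hP : 0 < p * M := by positivity
  have hk : k = k / (p * M) * (p * M) + k % (p * M) := by
    rw [mul_comm (k / _), Nat.div_add_mod]
  rw [hk, Finset.sum_range_add, sum_range_blocks_eq_zero hζ hζ1 hM hp, zero_add]
  set z := k / (p * M)
  have h1 : ∀ x ∈ Finset.range (k % (p * M)),
      B ((z * (p * M) + x) / (p * M)) * ζ ^ ((z * (p * M) + x) / M) = B z * ζ ^ (x / M) := by
    intro x hx
    have hx' : x < p * M := (Finset.mem_range.mp hx).trans (Nat.mod_lt _ hP)
    have e1 : (z * (p * M) + x) / (p * M) = z := by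
      rw [mul_comm, Nat.mul_add_div hP, Nat.div_eq_of_lt hx', add_zero]
    have e2 : (z * (p * M) + x) / M = p * z + x / M := by
      rw [show z * (p * M) + x = M * (p * z) + x by ring, Nat.mul_add_div hM]
    rw [e1, e2, pow_add, pow_mul, hζ, one_pow, one_mul]
  rw [Finset.sum_congr rfl h1, ← Finset.mul_sum, norm_mul]
  refine le_trans ?_ (norm_sum_range_pow_div_le hnorm hM (k % (p * M)))
  gcongr
  exact mul_le_of_le_one_left (norm_nonneg _) (hB z)

/-! ### Walsh coefficients of the indicator of an initial segment -/

/-- The pairing of `h` with the base `p` digits of `y < p ^ m`, most significant digit first. -/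
def digitPairing (p m : ℕ) (h : (ZMod p)[X]) (y : ℕ) : ZMod p :=
  ∑ i : Fin m, h.coeff i * ((y / p ^ (m - 1 - i) : ℕ) : ZMod p)

/-- Walsh coefficient at `h` of the indicator of `{y | y < k}` in `{0, …, p ^ m - 1}`. -/
def walshCoeff (p m : ℕ) [Fact p.Prime] (k : ℕ) (h : (ZMod p)[X]) : ℂ :=
  1 / (p : ℂ) ^ m * ∑ y ∈ Finset.range k, ZMod.stdAddChar (-digitPairing p m h y)

theorem walshCoeff_zero (p m : ℕ) [Fact p.Prime] (k : ℕ) :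
    walshCoeff p m k 0 = k / (p : ℂ) ^ m := by
  simp [walshCoeff, digitPairing]
  ring

/-- Fourier inversion: summing over `h` detects when `x` and `y` agree in all `m` digits, that is,
when `x = y`. -/
theorem sum_walshCoeff_mul (p m : ℕ) [Fact p.Prime] {k y : ℕ} (hk : k ≤ p ^ m) (hy : y < p ^ m) :
    ∑ h : degreeLT (ZMod p) m, walshCoeff p m k h * ZMod.stdAddChar (digitPairing p m h y) =
      if y < k then 1 else 0 := by
  have hp : (p : ℂ) ^ m ≠ 0 := pow_ne_zero _ (by exact_mod_cast (Fact.out : p.Prime).ne_zero)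
  have h1 : ∀ h : degreeLT (ZMod p) m,
      walshCoeff p m k h * ZMod.stdAddChar (digitPairing p m h y) =
      1 / (p : ℂ) ^ m * ∑ x ∈ Finset.range k, ZMod.stdAddChar (∑ i : Fin m,
        (h : (ZMod p)[X]).coeff i * (((y / p ^ (m - 1 - i) : ℕ) : ZMod p) -
          ((x / p ^ (m - 1 - i) : ℕ) : ZMod p))) := by
    intro h
    rw [walshCoeff, mul_assoc, Finset.sum_mul]
    congr 1
    refine Finset.sum_congr rfl fun x _ => ?_
    rw [← AddChar.map_add_eq_mul]
    congr 1
    simp only [digitPairing, mul_sub, Finset.sum_sub_distrib]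
    ring
  simp_rw [h1]
  rw [← Finset.mul_sum, Finset.sum_comm]
  simp_rw [sum_degreeLT_stdAddChar]
  have h2 : ∀ x ∈ Finset.range k, (if (fun i : Fin m => ((y / p ^ (m - 1 - i) : ℕ) : ZMod p) -
          ((x / p ^ (m - 1 - i) : ℕ) : ZMod p)) = 0 then (p : ℂ) ^ m else 0) =
        if y = x then (p : ℂ) ^ m else 0 := by
    intro x hx
    refine if_congr ⟨fun h => ?_, fun h => ?_⟩ rfl rfl
    · refine eq_of_digits_eq p hy ((Finset.mem_range.mp hx).trans_le hk) fun r hr => ?_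
      have := congrFun h ⟨m - 1 - r, by omega⟩
      simp only [Pi.zero_apply, sub_eq_zero] at this
      rwa [show m - 1 - (m - 1 - r) = r by omega] at this
    · subst h; ext i; simp
  rw [Finset.sum_congr rfl h2, Finset.sum_ite_eq]
  simp only [Finset.mem_range]
  split_ifs
  · field_simp
  · simp

theorem norm_stdAddChar_sub_one (p : ℕ) [NeZero p] (c : ZMod p) :
    ‖(ZMod.stdAddChar c : ℂ) - 1‖ = 2 * |Real.sin (Real.pi / p * (c.val : ℝ))| := by
  have h := ZMod.stdAddChar_coe (N := p) (c.val : ℤ)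
  rw [Int.cast_natCast, ZMod.natCast_zmod_val] at h
  have h2 : 2 * (Real.pi : ℂ) * Complex.I * ((c.val : ℤ) : ℂ) / p =
      Complex.I * ((2 * (Real.pi / p * (c.val : ℝ)) : ℝ) : ℂ) := by
    push_cast; ring
  rw [h, h2, Complex.norm_exp_I_mul_ofReal_sub_one]
  rw [norm_mul, Real.norm_eq_abs, Real.norm_eq_abs, abs_two]
  congr 3; ring

theorem stdAddChar_ne_one (p : ℕ) [NeZero p] {c : ZMod p} (hc : c ≠ 0) :
    (ZMod.stdAddChar c : ℂ) ≠ 1 := fun h =>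
  hc (ZMod.injective_stdAddChar (by rw [h, AddChar.map_zero_eq_one]))

theorem sin_ne_zero_of_ne_zero (p : ℕ) [NeZero p] {c : ZMod p} (hc : c ≠ 0) :
    Real.sin (Real.pi / p * (c.val : ℝ)) ≠ 0 := by
  intro h
  have := norm_stdAddChar_sub_one p c
  rw [h, abs_zero, mul_zero, norm_eq_zero, sub_eq_zero] at this
  exact stdAddChar_ne_one p hc this

/-- Let `a` be the degree of `h` and `M = p^(m-1-a)`. The leading coefficient meets the digit of `y
/ M`; lower coefficients meet only more significant digits, which are functions of `y / (p * M)`.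
This is the form required by the block sums. -/
theorem stdAddChar_digitPairing (p m : ℕ) [Fact p.Prime] {h : (ZMod p)[X]}
    (hdeg : h.natDegree < m) (y : ℕ) :
    (ZMod.stdAddChar (-digitPairing p m h y) : ℂ) =
      ZMod.stdAddChar (-∑ i ∈ Finset.range h.natDegree, h.coeff i *
        ((y / (p * p ^ (m - 1 - h.natDegree)) / p ^ (h.natDegree - 1 - i) : ℕ) : ZMod p)) *
      ZMod.stdAddChar (-h.leadingCoeff) ^ (y / p ^ (m - 1 - h.natDegree)) := by
  set a := h.natDegree with ha
  rw [← AddChar.map_nsmul_eq_pow, ← AddChar.map_add_eq_mul]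
  congr 1
  rw [digitPairing, Fin.sum_univ_eq_sum_range
    (fun i => h.coeff i * ((y / p ^ (m - 1 - i) : ℕ) : ZMod p)) m]
  rw [← Finset.sum_subset (Finset.range_subset_range.mpr (Nat.succ_le_of_lt hdeg)),
    Finset.sum_range_succ]
  · rw [neg_add]
    congr 1
    · congr 1
      refine Finset.sum_congr rfl fun i hi => ?_
      have hi' := Finset.mem_range.mp hi
      rw [Nat.div_div_eq_div_mul, mul_assoc, ← pow_add, ← pow_succ',
        show m - 1 - a + (a - 1 - i) + 1 = m - 1 - i by omega]
    · rw [nsmul_eq_mul, leadingCoeff, ← ha]; ring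
  · intro i _ hi
    rw [coeff_eq_zero_of_natDegree_lt, zero_mul]
    rw [Finset.mem_range] at hi
    omega

theorem stdAddChar_pow_self (p : ℕ) [NeZero p] (c : ZMod p) :
    (ZMod.stdAddChar c : ℂ) ^ p = 1 := by
  rw [← AddChar.map_nsmul_eq_pow]; simp

theorem walshCoeff_full (p m : ℕ) [Fact p.Prime] {h : (ZMod p)[X]} (h0 : h ≠ 0)
    (hdeg : h.natDegree < m) : walshCoeff p m (p ^ m) h = 0 := by
  have hp := (Fact.out : p.Prime).pos
  rw [walshCoeff, Finset.sum_congr rfl fun y _ => stdAddChar_digitPairing p m hdeg y]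
  have e : p ^ m = p ^ h.natDegree * (p * p ^ (m - 1 - h.natDegree)) := by
    rw [← pow_succ', ← pow_add]; congr 1; omega
  rw [e, sum_range_blocks_eq_zero (ζ := ZMod.stdAddChar (-h.leadingCoeff))
    (stdAddChar_pow_self p _)
    (stdAddChar_ne_one p (neg_ne_zero.mpr (leadingCoeff_ne_zero.mpr h0))) (by positivity) hp
    (fun z => ZMod.stdAddChar (-∑ i ∈ Finset.range h.natDegree, h.coeff i *
        ((z / p ^ (h.natDegree - 1 - i) : ℕ) : ZMod p))), mul_zero]

/-- The block estimate yields the stronger `1 / (p^(a+1) |sin|)`; `|sin| ≤ 1` then gives the squared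
sine of `rho`. -/
theorem norm_walshCoeff_le (p m : ℕ) [Fact p.Prime] {h : (ZMod p)[X]} (h0 : h ≠ 0)
    (hdeg : h.natDegree < m) (k : ℕ) : ‖walshCoeff p m k h‖ ≤ rho p h := by
  have hp := (Fact.out : p.Prime).pos
  have hp' : (0 : ℝ) < p := by exact_mod_cast hp
  have hlc : h.leadingCoeff ≠ 0 := leadingCoeff_ne_zero.mpr h0
  set a := h.natDegree with ha
  have hb := norm_sum_range_blocks_le (stdAddChar_pow_self p _)
    (stdAddChar_ne_one p (neg_ne_zero.mpr hlc)) (M := p ^ (m - 1 - a)) (by positivity) hp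
    (fun z => ZMod.stdAddChar (-∑ i ∈ Finset.range h.natDegree, h.coeff i *
        ((z / p ^ (h.natDegree - 1 - i) : ℕ) : ZMod p))) (fun z => (AddChar.norm_apply _ _).le) k
  have hs : ‖(ZMod.stdAddChar (-h.leadingCoeff) : ℂ) - 1‖ =
      2 * |Real.sin (Real.pi / p * (h.leadingCoeff.val : ℝ))| := by
    rw [← norm_stdAddChar_sub_one, AddChar.map_neg_eq_inv]
    have hn := AddChar.norm_apply (ZMod.stdAddChar (N := p)) h.leadingCoeff
    have hne : (ZMod.stdAddChar h.leadingCoeff : ℂ) ≠ 0 := norm_ne_zero_iff.mp (by rw [hn]; simp)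
    rw [← one_mul ‖_ - 1‖, ← hn, ← norm_mul, mul_sub, mul_inv_cancel₀ hne, mul_one, norm_sub_rev]
  rw [hs] at hb
  rw [walshCoeff, Finset.sum_congr rfl fun y _ => stdAddChar_digitPairing p m hdeg y, rho]
  set S := ∑ y ∈ Finset.range k, (ZMod.stdAddChar (-∑ i ∈ Finset.range h.natDegree, h.coeff i *
        ((y / (p * p ^ (m - 1 - h.natDegree)) / p ^ (h.natDegree - 1 - i) : ℕ) : ZMod p)) *
      ZMod.stdAddChar (-h.leadingCoeff) ^ (y / p ^ (m - 1 - h.natDegree)) : ℂ)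
  set σ := Real.sin (Real.pi / p * (h.leadingCoeff.val : ℝ)) with hσ
  have hσ0 : 0 < |σ| := abs_pos.mpr (sin_ne_zero_of_ne_zero p hlc)
  have hσ1 : |σ| ≤ 1 := Real.abs_sin_le_one _
  rw [norm_mul, norm_div, norm_pow, Complex.norm_natCast, norm_one, ← sq_abs σ]
  have hS : |σ| * ‖S‖ ≤ (p : ℝ) ^ (m - 1 - a) := by
    push_cast at hb; linarith
  have e : (p : ℝ) ^ m = (p : ℝ) ^ (a + 1) * (p : ℝ) ^ (m - 1 - a) := by
    rw [← pow_add]; congr 1; omega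
  rw [e, le_div_iff₀ (by positivity)]
  calc 1 / ((p : ℝ) ^ (a + 1) * (p : ℝ) ^ (m - 1 - a)) * ‖S‖ * ((p : ℝ) ^ (a + 1) * |σ| ^ 2)
      = |σ| * (|σ| * ‖S‖) / (p : ℝ) ^ (m - 1 - a) := by field_simp
    _ ≤ 1 * (p : ℝ) ^ (m - 1 - a) / (p : ℝ) ^ (m - 1 - a) := by gcongr
    _ = 1 := by field_simp

/-! ### Laurent series in `x⁻¹` -/

theorem toLaurent_C_mul_X_pow (p : ℕ) [Fact p.Prime] (c : ZMod p) (i : ℕ) :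
    toLaurent p (C c * X ^ i) = HahnSeries.single (-(i : ℤ)) c := by
  have hC : toLaurent p (C c) = HahnSeries.C c :=
    RingHom.congr_fun (Subsingleton.elim ((toLaurent p).toRingHom.comp C) HahnSeries.C) c
  have hX : toLaurent p (X ^ i) = HahnSeries.single (-(i : ℤ)) 1 := by
    rw [toLaurent, map_pow, aeval_X, HahnSeries.single_pow]
    simp
  rw [map_mul, hC, hX, HahnSeries.C_apply, HahnSeries.single_mul_single, zero_add, mul_one]

theorem eq_sum_C_mul_X_pow {R : Type*} [Semiring R] {m : ℕ} {h : R[X]} (hh : h.degree < m) :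
    h = ∑ i ∈ Finset.range m, C (h.coeff i) * X ^ i := by
  ext j
  simp only [finsetSum_coeff, coeff_C_mul, coeff_X_pow, mul_ite, mul_one, mul_zero,
    Finset.sum_ite_eq, Finset.mem_range]
  split_ifs with hj
  · rfl
  · exact coeff_eq_zero_of_degree_lt (hh.trans_le (by exact_mod_cast not_lt.mp hj))

theorem coeff_toLaurent_mul (p : ℕ) [Fact p.Prime] {m : ℕ} {h : (ZMod p)[X]}
    (hh : h.degree < m) (L : LaurentSeries (ZMod p)) (l : ℤ) :
    (toLaurent p h * L).coeff l = ∑ i : Fin m, h.coeff i * L.coeff (l + i) := by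
  rw [Fin.sum_univ_eq_sum_range (fun i => h.coeff i * L.coeff (l + i)) m]
  conv_lhs => rw [eq_sum_C_mul_X_pow hh]
  rw [map_sum, Finset.sum_mul, HahnSeries.coeff_sum]
  refine Finset.sum_congr rfl fun i _ => ?_
  rw [toLaurent_C_mul_X_pow, HahnSeries.coeff_single_mul, sub_neg_eq_add]

theorem coeff_toLaurent (p : ℕ) [Fact p.Prime] (h : (ZMod p)[X]) (l : ℤ) :
    (toLaurent p h).coeff l = if l ≤ 0 then h.coeff l.natAbs else 0 := by
  have hh : h.degree < ((h.natDegree + 1 : ℕ) : WithBot ℕ) :=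
    degree_le_natDegree.trans_lt (by exact_mod_cast Nat.lt_succ_self _)
  have := coeff_toLaurent_mul p hh 1 l
  rw [mul_one] at this
  rw [this, Fin.sum_univ_eq_sum_range
    (fun i => h.coeff i * (1 : LaurentSeries (ZMod p)).coeff (l + i))]
  simp only [HahnSeries.coeff_one, mul_ite, mul_one, mul_zero]
  split_ifs with hl
  · rw [Finset.sum_eq_single l.natAbs]
    · rw [if_pos (by omega)]
    · intro b _ hb; rw [if_neg (by omega)]
    · intro hn
      rw [coeff_eq_zero_of_natDegree_lt (by simpa using hn)]; simp
  · exact Finset.sum_eq_zero fun i _ => if_neg (by omega)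

theorem toLaurent_ne_zero (p : ℕ) [Fact p.Prime] {h : (ZMod p)[X]} (h0 : h ≠ 0) :
    toLaurent p h ≠ 0 := fun e => h0 <| by
  ext i
  have := coeff_toLaurent p h (-(i : ℤ))
  rw [if_pos (by omega), e] at this
  simpa using this.symm

theorem order_toLaurent (p : ℕ) [Fact p.Prime] {h : (ZMod p)[X]} (h0 : h ≠ 0) :
    (toLaurent p h).order = -(h.natDegree : ℤ) := by
  refine le_antisymm (HahnSeries.order_le_of_coeff_ne_zero ?_)
    ((HahnSeries.le_order_iff_forall (toLaurent_ne_zero p h0)).mpr fun j hj => ?_)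
  · rw [coeff_toLaurent, if_pos (by omega)]
    simpa using h0
  · rw [coeff_toLaurent, if_pos (by omega)]
    exact coeff_eq_zero_of_natDegree_lt (by omega)

/-- If the remainder `B` of `Q` modulo `f` is nonzero, `B / f` has order `deg f - deg B`, which lies
between `1` and `deg f`. The coefficient there is nonzero, and the polynomial quotient contributes
nothing to it. -/
theorem dvd_of_coeff_div_eq_zero (p : ℕ) [Fact p.Prime] {f Q : (ZMod p)[X]} (hf : f ≠ 0)
    (h : ∀ r < f.natDegree, (toLaurent p Q / toLaurent p f).coeff ((r : ℤ) + 1) = 0) : f ∣ Q := by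
  rw [← EuclideanDomain.mod_eq_zero]
  by_contra hB
  set B := Q % f with hBdef
  set A := Q / f
  have hF := toLaurent_ne_zero p hf
  have hdeg : B.natDegree < f.natDegree :=
    natDegree_lt_natDegree hB (EuclideanDomain.mod_lt Q hf)
  have hQ : toLaurent p Q / toLaurent p f = toLaurent p A + toLaurent p B / toLaurent p f := by
    rw [eq_comm, ← EuclideanDomain.div_add_mod Q f, map_add, map_mul, add_div,
      mul_div_cancel_left₀ _ hF]
  set T := toLaurent p B / toLaurent p f with hT
  have hTF : T * toLaurent p f = toLaurent p B := div_mul_cancel₀ _ hF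
  have hT0 : T ≠ 0 := fun e => toLaurent_ne_zero p hB (by rw [← hTF, e, zero_mul])
  have hord := HahnSeries.order_mul hT0 hF
  rw [hTF, order_toLaurent p hB, order_toLaurent p hf] at hord
  refine hT0 (HahnSeries.coeff_order_eq_zero.mp ?_)
  have h1 := h (f.natDegree - B.natDegree - 1) (by omega)
  have h2 : ((f.natDegree - B.natDegree - 1 : ℕ) : ℤ) + 1 = T.order := by omega
  rw [h2, hQ, HahnSeries.coeff_add, coeff_toLaurent, if_neg (by omega), zero_add] at h1
  exact h1

/-! ### Coordinates and characters of polynomial lattice points -/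

/-- The integer `p ^ m * φ_m(L)`. -/
def phiNum (p m : ℕ) [Fact p.Prime] (L : LaurentSeries (ZMod p)) : Fin (p ^ m) :=
  (digitEquiv p m).symm fun i => L.coeff ((m : ℤ) - i)

theorem phi_eq_phiNum_div (p m : ℕ) [Fact p.Prime] (L : LaurentSeries (ZMod p)) :
    phi p m L = (phiNum p m L : ℕ) / (p : ℝ) ^ m := by
  have hp : (p : ℝ) ≠ 0 := by exact_mod_cast (Fact.out : p.Prime).ne_zero
  rw [phi, phiNum, digitEquiv_symm_val, Nat.cast_sum, Finset.sum_div,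
    Fin.sum_univ_eq_sum_range (fun i : ℕ =>
      (((L.coeff ((m : ℤ) - i)).val * p ^ i : ℕ) : ℝ) / (p : ℝ) ^ m)]
  refine Finset.sum_nbij' (fun l => m - l) (fun i => m - i) ?_ ?_ ?_ ?_ ?_
  · intro l hl; simp only [Finset.mem_Icc, Finset.mem_range] at *; omega
  · intro l hl; simp only [Finset.mem_Icc, Finset.mem_range] at *; omega
  · intro l hl; simp only [Finset.mem_Icc] at *; omega
  · intro l hl; simp only [Finset.mem_range] at *; omega
  · intro l hl
    have hl' := Finset.mem_Icc.mp hl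
    rw [show (m : ℤ) - ((m - l : ℕ) : ℤ) = l by omega]
    have e : (p : ℝ) ^ m = (p : ℝ) ^ (m - l) * (p : ℝ) ^ l := by rw [← pow_add]; congr 1; omega
    rw [e]
    push_cast
    field_simp

/-- Reading digits from the most significant pairs `h_i` with the coefficient of `x^{-(i+1)}`, so
the pairing is the residue of `h L`, which is additive in `L`. -/
theorem digitPairing_phiNum (p m : ℕ) [Fact p.Prime] {h : (ZMod p)[X]} (hh : h.degree < m)
    (L : LaurentSeries (ZMod p)) :
    digitPairing p m h (phiNum p m L) = (toLaurent p h * L).coeff 1 := by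
  rw [coeff_toLaurent_mul p hh, digitPairing]
  refine Finset.sum_congr rfl fun i _ => ?_
  have := digitEquiv_apply p m (phiNum p m L) ⟨m - 1 - i, by omega⟩
  rw [← this, phiNum, Equiv.apply_symm_apply]
  congr 2
  simp only
  omega

theorem natPoly_degree_lt (p m n : ℕ) : (natPoly p m n).degree < m := by
  rw [natPoly, ← mem_degreeLT]
  refine Submodule.sum_mem _ fun i hi => ?_
  rw [mem_degreeLT]
  exact (degree_C_mul_X_pow_le _ _).trans_lt (by exact_mod_cast Finset.mem_range.mp hi)

theorem natPoly_coeff (p m n : ℕ) (r : Fin m) :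
    (natPoly p m n).coeff r = ((n / p ^ (r : ℕ) : ℕ) : ZMod p) := by
  simp [natPoly, coeff_X_pow]

/-- The characters of `𝔽_p[x]` attached to `h` with `f ∤ h · q` sum to zero over the lattice. -/
theorem sum_stdAddChar_lattice (p m : ℕ) [Fact p.Prime] {s : ℕ} {f : (ZMod p)[X]} (hf : f ≠ 0)
    (hfm : f.natDegree = m) (q : Fin s → (ZMod p)[X]) (h : Fin s → degreeLT (ZMod p) m)
    (hd : ¬ f ∣ ∑ j, (h j : (ZMod p)[X]) * q j) :
    ∑ n : Fin (p ^ m), ∏ j, (ZMod.stdAddChar (digitPairing p m (h j)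
      (phiNum p m (toLaurent p (natPoly p m n * q j) / toLaurent p f))) : ℂ) = 0 := by
  set Q := ∑ j, (h j : (ZMod p)[X]) * q j with hQ
  -- The residues add up to that of `n(x) Q / f`, a linear form in the digits of `n`.
  have h1 : ∀ n : Fin (p ^ m), ∏ j, (ZMod.stdAddChar (digitPairing p m (h j)
      (phiNum p m (toLaurent p (natPoly p m n * q j) / toLaurent p f))) : ℂ) =
      ZMod.stdAddChar (∑ r : Fin m, ((n / p ^ (r : ℕ) : ℕ) : ZMod p) *
        (toLaurent p Q / toLaurent p f).coeff (1 + r)) := by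
    intro n
    rw [← stdAddChar_sum]
    congr 1
    simp_rw [← natPoly_coeff p m n]
    rw [← coeff_toLaurent_mul p (natPoly_degree_lt p m n), hQ, map_sum, Finset.sum_div,
      Finset.mul_sum, HahnSeries.coeff_sum]
    refine Finset.sum_congr rfl fun j _ => ?_
    rw [digitPairing_phiNum p m (mem_degreeLT.mp (h j).2)]
    congr 1
    rw [map_mul, map_mul]
    ring
  simp_rw [h1]
  rw [sum_fin_stdAddChar p (fun r : Fin m => (toLaurent p Q / toLaurent p f).coeff (1 + (r : ℤ))),
    if_neg]
  intro h0
  refine hd (dvd_of_coeff_div_eq_zero p hf fun r hr => ?_)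
  rw [add_comm]
  exact congrFun h0 ⟨r, hfm ▸ hr⟩

/-! ### Bounding the discrepancy by `R` -/

/-- Induction on `u`. With `X = A - B` and `Y = a - b`, the difference `X + Y - XY - (aA - bB)`
equals `X(1 - a) + Y(1 - A)`, which is nonnegative. -/
theorem prod_sub_prod_le {ι : Type*} (u : Finset ι) (a b : ι → ℝ) {δ : ℝ} (hδ1 : δ ≤ 1)
    (hb : ∀ j ∈ u, 0 ≤ b j) (hba : ∀ j ∈ u, b j ≤ a j) (ha : ∀ j ∈ u, a j ≤ 1)
    (hd : ∀ j ∈ u, a j - b j ≤ δ) :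
    ∏ j ∈ u, a j - ∏ j ∈ u, b j ≤ 1 - (1 - δ) ^ u.card := by
  classical
  induction u using Finset.induction_on with
  | empty => simp
  | insert i u hi ih =>
    simp only [Finset.mem_insert, forall_eq_or_imp] at hb hba ha hd
    have ih := ih hb.2 hba.2 ha.2 hd.2
    rw [Finset.prod_insert hi, Finset.prod_insert hi, Finset.card_insert_of_notMem hi, pow_succ]
    have hA1 : ∏ j ∈ u, a j ≤ 1 :=
      Finset.prod_le_one (fun j hj => (hb.2 j hj).trans (hba.2 j hj)) ha.2
    have hBA : ∏ j ∈ u, b j ≤ ∏ j ∈ u, a j := Finset.prod_le_prod hb.2 hba.2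
    have hB : 0 ≤ ∏ j ∈ u, b j := Finset.prod_nonneg hb.2
    set A := ∏ j ∈ u, a j
    set B := ∏ j ∈ u, b j
    set e := (1 - δ) ^ u.card
    have h1 : a i * A - b i * B ≤ 1 - (1 - (A - B)) * (1 - (a i - b i)) := by
      nlinarith [mul_nonneg (sub_nonneg.mpr hBA) (sub_nonneg.mpr ha.1),
        mul_nonneg (sub_nonneg.mpr hba.1) (sub_nonneg.mpr hA1)]
    have h2 : e * (1 - δ) ≤ (1 - (A - B)) * (1 - (a i - b i)) :=
      mul_le_mul (by linarith) (by linarith [hd.1]) (by linarith) (by linarith)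
    linarith

/-- Coordinate `j` of the `n`th lattice point, in units of `p ^ (-m)`. -/
def latticeNum (p : ℕ) [Fact p.Prime] (m : ℕ) {s : ℕ} (q : Fin s → (ZMod p)[X])
    (f : (ZMod p)[X]) (n : Fin (p ^ m)) (j : Fin s) : Fin (p ^ m) :=
  phiNum p m (toLaurent p (natPoly p m n * q j) / toLaurent p f)

theorem latticePoint_eq (p : ℕ) [Fact p.Prime] (m : ℕ) {s : ℕ} (q : Fin s → (ZMod p)[X])
    (f : (ZMod p)[X]) (n : Fin (p ^ m)) (j : Fin s) :
    latticePoint p m q f n j = (latticeNum p m q f n j : ℕ) / (p : ℝ) ^ m :=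
  phi_eq_phiNum_div p m _

open Classical in
theorem norm_count_sub_prod_le (p m : ℕ) [Fact p.Prime] {s : ℕ} {f : (ZMod p)[X]} (hf : f ≠ 0)
    (hfm : f.natDegree = m) (q : Fin s → (ZMod p)[X]) (k : Fin s → ℕ) (hk : ∀ j, k j ≤ p ^ m) :
    ‖1 / (p : ℂ) ^ m * ∑ n, ∏ j, (if (latticeNum p m q f n j : ℕ) < k j then 1 else 0) -
        ∏ j, (k j : ℂ) / (p : ℂ) ^ m‖ ≤
      ∑ h : Fin s → degreeLT (ZMod p) m with
        h ≠ 0 ∧ f ∣ ∑ i, (h i : (ZMod p)[X]) * q i, ∏ j, ‖walshCoeff p m (k j) (h j)‖ := by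
  have hp0 : (p : ℂ) ^ m ≠ 0 := pow_ne_zero _ (by exact_mod_cast (Fact.out : p.Prime).ne_zero)
  have hpR : (p : ℝ) ^ m ≠ 0 := pow_ne_zero _ (by exact_mod_cast (Fact.out : p.Prime).ne_zero)
  set E : (Fin s → degreeLT (ZMod p) m) → ℂ := fun h => 1 / (p : ℂ) ^ m * ∑ n : Fin (p ^ m),
    ∏ j, ZMod.stdAddChar (digitPairing p m (h j) (latticeNum p m q f n j)) with hE
  have h1 : 1 / (p : ℂ) ^ m * ∑ n, ∏ j, (if (latticeNum p m q f n j : ℕ) < k j then 1 else 0) =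
      ∑ h : Fin s → degreeLT (ZMod p) m, (∏ j, walshCoeff p m (k j) (h j)) * E h := by
    have : ∀ n : Fin (p ^ m), ∏ j, (if (latticeNum p m q f n j : ℕ) < k j then (1 : ℂ) else 0) =
        ∑ h : Fin s → degreeLT (ZMod p) m, (∏ j, walshCoeff p m (k j) (h j)) *
          ∏ j, ZMod.stdAddChar (digitPairing p m (h j) (latticeNum p m q f n j)) := by
      intro n
      simp_rw [← sum_walshCoeff_mul p m (hk _) (latticeNum p m q f n _).2]
      rw [Finset.prod_univ_sum, Fintype.piFinset_univ]
      simp_rw [Finset.prod_mul_distrib]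
    simp_rw [this, hE]
    rw [Finset.sum_comm, Finset.mul_sum]
    refine Finset.sum_congr rfl fun h _ => ?_
    rw [← Finset.mul_sum]
    ring
  have hE0 : E 0 = 1 := by
    simp only [hE, digitPairing, Pi.zero_apply, ZeroMemClass.coe_zero, coeff_zero, zero_mul,
      Finset.sum_const_zero, AddChar.map_zero_eq_one, Finset.prod_const_one, Finset.sum_const,
      Finset.card_univ, Fintype.card_fin, nsmul_eq_mul, mul_one, Nat.cast_pow]
    field_simp
  have hE1 : ∀ h, ‖E h‖ ≤ 1 := by
    intro h
    rw [hE]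
    simp only
    rw [norm_mul, norm_div, norm_one, norm_pow, Complex.norm_natCast]
    have : ‖∑ n : Fin (p ^ m), ∏ j, (ZMod.stdAddChar
        (digitPairing p m (h j) (latticeNum p m q f n j)) : ℂ)‖ ≤ (p : ℝ) ^ m := by
      refine (norm_sum_le _ _).trans (le_of_eq ?_)
      simp [norm_prod, AddChar.norm_apply]
    calc _ ≤ 1 / (p : ℝ) ^ m * (p : ℝ) ^ m := by gcongr
      _ = 1 := by field_simp
  have hE2 : ∀ h : Fin s → degreeLT (ZMod p) m,
      ¬ f ∣ ∑ i, (h i : (ZMod p)[X]) * q i → E h = 0 := fun h hd => by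
    simp only [hE, latticeNum]
    rw [sum_stdAddChar_lattice p m hf hfm q h hd, mul_zero]
  have h2 : ∏ j, (k j : ℂ) / (p : ℂ) ^ m =
      (∏ j, walshCoeff p m (k j) ((0 : Fin s → degreeLT (ZMod p) m) j)) * E 0 := by
    rw [hE0, mul_one]
    simp [walshCoeff_zero]
  rw [h1, h2, ← Finset.add_sum_erase _ _ (Finset.mem_univ (0 : Fin s → degreeLT (ZMod p) m)),
    add_sub_cancel_left]
  have h3 : ∑ h : Fin s → degreeLT (ZMod p) m with
        h ≠ 0 ∧ f ∣ ∑ i, (h i : (ZMod p)[X]) * q i, (∏ j, walshCoeff p m (k j) (h j)) * E h =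
      ∑ h ∈ Finset.univ.erase (0 : Fin s → degreeLT (ZMod p) m),
        (∏ j, walshCoeff p m (k j) (h j)) * E h := by
    refine Finset.sum_subset (fun h hh => ?_) fun h hh hh' => ?_
    · simp only [Finset.mem_filter] at hh
      simp [hh.2.1]
    · rw [hE2 h, mul_zero]
      intro hd
      exact hh' (by simp [hd, Finset.ne_of_mem_erase hh])
  rw [← h3]
  refine (norm_sum_le _ _).trans (Finset.sum_le_sum fun h _ => ?_)
  rw [norm_mul, norm_prod]
  exact mul_le_of_le_one_right (Finset.prod_nonneg fun _ _ => norm_nonneg _) (hE1 h)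

theorem rho_nonneg (p : ℕ) (h : (ZMod p)[X]) : 0 ≤ rho p h := by
  rw [rho]; positivity

theorem rhoW_nonneg (p : ℕ) (h : (ZMod p)[X]) {γ : ℝ} (hγ : 0 ≤ γ) : 0 ≤ rhoW p h γ := by
  rw [rhoW]
  have := rho_nonneg p h
  split_ifs <;> positivity

theorem R_nonneg (p : ℕ) [Fact p.Prime] (m : ℕ) {d : ℕ} (γ : Fin d → ℝ) (hγ : ∀ i, 0 ≤ γ i)
    (q : Fin d → (ZMod p)[X]) (f : (ZMod p)[X]) : 0 ≤ R p m γ q f :=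
  Finset.sum_nonneg fun _ _ => Finset.prod_nonneg fun i _ => rhoW_nonneg p _ (hγ i)

theorem weight_mul_norm_walshCoeff_le (p m : ℕ) [Fact p.Prime] (h : degreeLT (ZMod p) m) {γ : ℝ}
    (hγ : 0 ≤ γ) {k : ℕ} (hk : k ≤ p ^ m) :
    γ * ‖walshCoeff p m k h‖ ≤ rhoW p h γ := by
  rw [rhoW]
  split_ifs with h0
  · have hp : (0 : ℝ) < (p : ℝ) ^ m := pow_pos (by exact_mod_cast (Fact.out : p.Prime).pos) _
    rw [h0, walshCoeff_zero, norm_div, norm_pow, Complex.norm_natCast, Complex.norm_natCast]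
    have : (k : ℝ) / (p : ℝ) ^ m ≤ 1 := by
      rw [div_le_one hp]; exact_mod_cast hk
    nlinarith
  · have hd := (natDegree_lt_iff_degree_lt h0).mpr (mem_degreeLT.mp h.2)
    exact mul_le_mul_of_nonneg_left (norm_walshCoeff_le p m h0 hd k) hγ

/-- For coordinates outside `u`, which carry no weight factor: only `h = 0` survives, and the
summand `1` of `1 + γ` pays for it. -/
theorem norm_walshCoeff_full_le (p m : ℕ) [Fact p.Prime] (h : degreeLT (ZMod p) m) {γ : ℝ}
    (hγ : 0 ≤ γ) : ‖walshCoeff p m (p ^ m) h‖ ≤ rhoW p h γ := by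
  by_cases h0 : (h : (ZMod p)[X]) = 0
  · have hp : (p : ℂ) ^ m ≠ 0 := pow_ne_zero _ (by exact_mod_cast (Fact.out : p.Prime).ne_zero)
    rw [rhoW, if_pos h0, h0, walshCoeff_zero, Nat.cast_pow, div_self hp, norm_one]
    linarith
  · have hd := (natDegree_lt_iff_degree_lt h0).mpr (mem_degreeLT.mp h.2)
    rw [walshCoeff_full p m h0 hd, norm_zero]
    exact rhoW_nonneg p _ hγ

theorem indicator_box_latticePoint (p m : ℕ) [Fact p.Prime] {s : ℕ} (q : Fin s → (ZMod p)[X])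
    (f : (ZMod p)[X]) (t : Fin s → ℝ) (n : Fin (p ^ m)) :
    (box t).indicator (fun _ => (1 : ℝ)) (latticePoint p m q f n) =
      ∏ j, if (latticeNum p m q f n j : ℕ) < ⌈t j * (p : ℝ) ^ m⌉₊ then (1 : ℝ) else 0 := by
  classical
  have hp : (0 : ℝ) < (p : ℝ) ^ m := pow_pos (by exact_mod_cast (Fact.out : p.Prime).pos) _
  have key : ∀ j, latticePoint p m q f n j ∈ Set.Ico 0 (t j) ↔
      (latticeNum p m q f n j : ℕ) < ⌈t j * (p : ℝ) ^ m⌉₊ := by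
    intro j
    rw [latticePoint_eq, Set.mem_Ico, Nat.lt_ceil, div_lt_iff₀ hp]
    exact and_iff_right (by positivity)
  rw [Finset.prod_ite_zero, Set.indicator_apply]
  simp only [box, Set.mem_pi, Set.mem_univ, forall_true_left, key, Finset.mem_univ,
    Finset.prod_const_one]

theorem weight_mul_localDisc_le (p m : ℕ) [Fact p.Prime] {s : ℕ} {f : (ZMod p)[X]} (hf : f ≠ 0)
    (hfm : f.natDegree = m) (q : Fin s → (ZMod p)[X]) (γ : Fin s → ℝ) (hγ : ∀ i, 0 ≤ γ i)
    (t : Fin s → ℝ) (ht0 : ∀ j, 0 < t j) (ht1 : ∀ j, t j ≤ 1) (u : Finset (Fin s)) :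
    prodWeight γ u * |localDisc (latticePoint p m q f) (fillOne u t)| ≤
      prodWeight γ u * (1 - (1 - 1 / (p : ℝ) ^ m) ^ u.card) + R p m γ q f := by
  classical
  have hpp := (Fact.out : p.Prime)
  have hp1 : (1 : ℝ) ≤ (p : ℝ) ^ m := one_le_pow₀ (by exact_mod_cast hpp.one_le)
  have hp : (0 : ℝ) < (p : ℝ) ^ m := by linarith
  set T := fillOne u t with hT
  have hT0 : ∀ j, 0 < T j := fun j => by
    simp only [hT, fillOne]; split_ifs; exacts [ht0 j, one_pos]
  have hT1 : ∀ j, T j ≤ 1 := fun j => by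
    simp only [hT, fillOne]; split_ifs; exacts [ht1 j, le_rfl]
  set k : Fin s → ℕ := fun j => ⌈T j * (p : ℝ) ^ m⌉₊ with hk
  have hkle : ∀ j, k j ≤ p ^ m := fun j => by
    refine Nat.ceil_le.mpr ?_
    push_cast
    exact mul_le_of_le_one_left hp.le (hT1 j)
  have hknot : ∀ j, j ∉ u → k j = p ^ m := fun j hj => by
    have : T j = 1 := by simp [hT, fillOne, hj]
    rw [hk]; simp only
    rw [this, one_mul]; exact_mod_cast Nat.ceil_natCast (p ^ m)
  have hW : 0 ≤ prodWeight γ u := Finset.prod_nonneg fun j _ => hγ j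
  have hcount : prodWeight γ u * |1 / (p : ℝ) ^ m * ∑ n, ∏ j,
        (if (latticeNum p m q f n j : ℕ) < k j then (1 : ℝ) else 0) -
          ∏ j, (k j : ℝ) / (p : ℝ) ^ m| ≤ R p m γ q f := by
    have h1 := norm_count_sub_prod_le p m hf hfm q k hkle
    have h2 : (1 / (p : ℂ) ^ m * ∑ n, ∏ j, (if (latticeNum p m q f n j : ℕ) < k j then 1 else 0) -
        ∏ j, (k j : ℂ) / (p : ℂ) ^ m) = ((1 / (p : ℝ) ^ m * ∑ n, ∏ j,
        (if (latticeNum p m q f n j : ℕ) < k j then (1 : ℝ) else 0) -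
          ∏ j, (k j : ℝ) / (p : ℝ) ^ m : ℝ) : ℂ) := by
      push_cast [apply_ite Complex.ofReal]; rfl
    rw [h2, Complex.norm_real, Real.norm_eq_abs] at h1
    refine (mul_le_mul_of_nonneg_left h1 hW).trans ?_
    rw [Finset.mul_sum, R]
    refine le_of_le_of_eq (Finset.sum_le_sum fun h _ => ?_) (by congr!)
    have h3 : prodWeight γ u = ∏ j, if j ∈ u then γ j else 1 := by
      rw [prodWeight, Finset.prod_ite_mem, Finset.univ_inter]
    rw [h3, ← Finset.prod_mul_distrib]
    refine Finset.prod_le_prod (fun j _ => ?_) fun j _ => ?_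
    · have := hγ j
      split_ifs <;> positivity
    · split_ifs with hj
      · exact weight_mul_norm_walshCoeff_le p m (h j) (hγ j) (hkle j)
      · rw [one_mul, hknot j hj]
        exact norm_walshCoeff_full_le p m (h j) (hγ j)
  have hround0 : ∀ j, T j ≤ (k j : ℝ) / (p : ℝ) ^ m := fun j => by
    rw [le_div_iff₀ hp]; exact Nat.le_ceil _
  have hround1 : ∀ j, (k j : ℝ) / (p : ℝ) ^ m - T j ≤ 1 / (p : ℝ) ^ m := fun j => by
    have := (Nat.ceil_lt_add_one (mul_nonneg (hT0 j).le hp.le)).le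
    rw [sub_le_iff_le_add, div_le_iff₀ hp, add_mul, div_mul_cancel₀ _ hp.ne']
    linarith
  have hk1 : ∀ j, (k j : ℝ) / (p : ℝ) ^ m ≤ 1 := fun j => by
    rw [div_le_one hp]; exact_mod_cast hkle j
  have hprodu : ∀ a : Fin s → ℝ, (∀ j, j ∉ u → a j = 1) → ∏ j, a j = ∏ j ∈ u, a j := fun a ha =>
    (Finset.prod_subset (Finset.subset_univ u) fun j _ hj => ha j hj).symm
  have hround : |∏ j, (k j : ℝ) / (p : ℝ) ^ m - ∏ j, T j| ≤
      1 - (1 - 1 / (p : ℝ) ^ m) ^ u.card := by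
    rw [abs_of_nonneg (sub_nonneg.mpr
      (Finset.prod_le_prod (fun j _ => (hT0 j).le) fun j _ => hround0 j))]
    rw [hprodu T fun j hj => by simp [hT, fillOne, hj], hprodu (fun j => (k j : ℝ) / (p : ℝ) ^ m)
      fun j hj => by rw [hknot j hj]; push_cast; exact div_self hp.ne']
    exact prod_sub_prod_le u _ _ (by rw [div_le_one hp]; exact hp1) (fun j _ => (hT0 j).le)
      (fun j _ => hround0 j) (fun j _ => hk1 j) fun j _ => hround1 j
  rw [localDisc]
  simp_rw [indicator_box_latticePoint]
  -- Insert the volume of the rounded box: one difference is the rounding error, the other is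
  -- controlled by `R`.
  rw [Nat.cast_pow, ← sub_add_sub_cancel _ (∏ j, (k j : ℝ) / (p : ℝ) ^ m), add_comm]
  refine (mul_le_mul_of_nonneg_left (abs_add_le _ _) hW).trans ?_
  rw [mul_add]
  exact add_le_add (mul_le_mul_of_nonneg_left hround hW) hcount

theorem weightedStarDisc_le_add_R (p m : ℕ) [Fact p.Prime] {s : ℕ} {f : (ZMod p)[X]} (hf : f ≠ 0)
    (hfm : f.natDegree = m) (q : Fin s → (ZMod p)[X]) (γ : Fin s → ℝ) (hγ : ∀ i, 0 ≤ γ i) :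
    weightedStarDisc (prodWeight γ) (latticePoint p m q f) ≤
      (∑ u : Finset (Fin s) with u.Nonempty,
        prodWeight γ u * (1 - (1 - 1 / (p : ℝ) ^ m) ^ u.card)) + R p m γ q f := by
  have hpp := (Fact.out : p.Prime)
  have hp1 : (1 : ℝ) ≤ (p : ℝ) ^ m := one_le_pow₀ (by exact_mod_cast hpp.one_le)
  have hterm : ∀ u : Finset (Fin s),
      0 ≤ prodWeight γ u * (1 - (1 - 1 / (p : ℝ) ^ m) ^ u.card) := fun u => by
    refine mul_nonneg (Finset.prod_nonneg fun j _ => hγ j) (sub_nonneg.mpr (pow_le_one₀ ?_ ?_))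
    · rw [sub_nonneg, div_le_one (by linarith)]; exact hp1
    · have : (0 : ℝ) ≤ 1 / (p : ℝ) ^ m := by positivity
      linarith
  -- A bound on a real supremum through `Real.iSup_le` must be nonnegative, as the supremum of an
  -- empty family is `0`.
  have h0 := add_nonneg (Finset.sum_nonneg fun u (_ : u ∈ Finset.univ.filter
    fun u : Finset (Fin s) => u.Nonempty) => hterm u) (R_nonneg p m γ hγ q f)
  refine Real.iSup_le (fun t => Real.iSup_le (fun u => ?_) h0) h0
  refine (weight_mul_localDisc_le p m hf hfm q γ hγ t.1 (fun j => (t.2 j trivial).1)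
    (fun j => (t.2 j trivial).2) u.1).trans ?_
  gcongr
  exact Finset.single_le_sum (f := fun u : Finset (Fin s) =>
    prodWeight γ u * (1 - (1 - 1 / (p : ℝ) ^ m) ^ u.card)) (fun u _ => hterm u)
    (by simpa using u.2)

/-! ### The sum of squared cosecants -/

theorem sub_one_mul_sum_range_mul_pow {A : Type*} [CommRing A] (ζ : A) (n : ℕ) :
    (ζ - 1) * ∑ j ∈ Finset.range n, (j : A) * ζ ^ j =
      n * ζ ^ n - ζ * ∑ j ∈ Finset.range n, ζ ^ j := by
  induction n with
  | zero => simp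
  | succ n ih =>
    rw [Finset.sum_range_succ, mul_add, ih, Finset.sum_range_succ]
    push_cast
    ring

theorem sum_range_cast_real (n : ℕ) : ∑ j ∈ Finset.range n, (j : ℝ) = n * (n - 1) / 2 := by
  induction n with
  | zero => simp
  | succ n ih => rw [Finset.sum_range_succ, ih]; push_cast; ring

theorem sum_range_sq_real (n : ℕ) :
    ∑ j ∈ Finset.range n, (j : ℝ) ^ 2 = (n - 1) * n * (2 * n - 1) / 6 := by
  induction n with
  | zero => simp
  | succ n ih => rw [Finset.sum_range_succ, ih]; push_cast; ring

/-- Parseval for the function `j ↦ j` on `ZMod p`. -/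
theorem sum_norm_sq_sum_range_mul_pow (p : ℕ) [Fact p.Prime] :
    ∑ c : ZMod p, ‖∑ j ∈ Finset.range p, (j : ℂ) * ZMod.stdAddChar c ^ j‖ ^ 2 =
      p * ∑ j ∈ Finset.range p, (j : ℝ) ^ 2 := by
  have h1 : ∀ c : ZMod p, ((‖∑ j ∈ Finset.range p, (j : ℂ) * ZMod.stdAddChar c ^ j‖ ^ 2 : ℝ) : ℂ) =
      ∑ i ∈ Finset.range p, ∑ j ∈ Finset.range p, (i : ℂ) * j *
        ZMod.stdAddChar (c * ((i : ZMod p) - (j : ZMod p))) := by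
    intro c
    rw [Complex.ofReal_pow, ← Complex.mul_conj', map_sum, Finset.sum_mul_sum]
    refine Finset.sum_congr rfl fun i _ => Finset.sum_congr rfl fun j _ => ?_
    rw [map_mul, map_pow, ← AddChar.map_neg_eq_conj, Complex.conj_natCast,
      ← AddChar.map_nsmul_eq_pow, ← AddChar.map_nsmul_eq_pow]
    rw [mul_mul_mul_comm, ← AddChar.map_add_eq_mul]
    congr 2
    simp only [nsmul_eq_mul]
    ring
  have h2 : ∀ i ∈ Finset.range p, ∀ j ∈ Finset.range p,
      ((i : ZMod p) - (j : ZMod p) = 0 ↔ i = j) := by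
    intro i hi j hj
    rw [sub_eq_zero, ZMod.natCast_eq_natCast_iff', Nat.mod_eq_of_lt (Finset.mem_range.mp hi),
      Nat.mod_eq_of_lt (Finset.mem_range.mp hj)]
  rw [← Complex.ofReal_inj, Complex.ofReal_sum, Finset.sum_congr rfl fun c _ => h1 c,
    Finset.sum_comm]
  push_cast
  rw [Finset.mul_sum]
  refine Finset.sum_congr rfl fun i hi => ?_
  rw [Finset.sum_comm, Finset.sum_eq_single i]
  · simp only [sub_self, mul_zero, AddChar.map_zero_eq_one, mul_one, Finset.sum_const,
      Finset.card_univ, ZMod.card, nsmul_eq_mul]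
    ring
  · intro j hj hji
    rw [← Finset.mul_sum, AddChar.sum_mulShift _ (ZMod.isPrimitive_stdAddChar p),
      if_neg (fun h => hji ((h2 i hi j hj).mp h).symm), Nat.cast_zero, mul_zero]
  · exact fun h => absurd hi h

/-- For `c ≠ 0` the Fourier coefficient of `j ↦ j` is `p / (ζ - 1)`, with squared norm `p² / (4
sin²)`. Subtracting the `c = 0` term from Parseval leaves the claim. -/
theorem sum_one_div_sin_sq (p : ℕ) [Fact p.Prime] :
    ∑ c ∈ Finset.univ.erase (0 : ZMod p), 1 / Real.sin (Real.pi / p * (c.val : ℝ)) ^ 2 =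
      ((p : ℝ) ^ 2 - 1) / 3 := by
  have hp : (p : ℝ) ≠ 0 := by exact_mod_cast (Fact.out : p.Prime).ne_zero
  have h := sum_norm_sq_sum_range_mul_pow p
  rw [← Finset.add_sum_erase _ _ (Finset.mem_univ (0 : ZMod p)), sum_range_sq_real] at h
  have h0 : ‖∑ j ∈ Finset.range p, (j : ℂ) * ZMod.stdAddChar (0 : ZMod p) ^ j‖ =
      (p : ℝ) * (p - 1) / 2 := by
    have : ∑ j ∈ Finset.range p, (j : ℂ) * ZMod.stdAddChar (0 : ZMod p) ^ j =
        ((∑ j ∈ Finset.range p, (j : ℝ) : ℝ) : ℂ) := by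
      push_cast
      simp
    rw [this, Complex.norm_real, Real.norm_of_nonneg (Finset.sum_nonneg fun _ _ => by positivity),
      sum_range_cast_real]
  have h1 : ∀ c ∈ Finset.univ.erase (0 : ZMod p),
      ‖∑ j ∈ Finset.range p, (j : ℂ) * ZMod.stdAddChar c ^ j‖ ^ 2 =
        (p : ℝ) ^ 2 / 4 * (1 / Real.sin (Real.pi / p * (c.val : ℝ)) ^ 2) := by
    intro c hc
    have hc0 := Finset.ne_of_mem_erase hc
    have hs := sin_ne_zero_of_ne_zero p hc0
    have hne := sub_ne_zero.mpr (stdAddChar_ne_one p hc0)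
    have h2 := sub_one_mul_sum_range_mul_pow (ZMod.stdAddChar c : ℂ) p
    have h3 := mul_geom_sum (ZMod.stdAddChar c : ℂ) p
    rw [stdAddChar_pow_self, sub_self] at h3
    rw [(mul_eq_zero.mp h3).resolve_left hne, stdAddChar_pow_self, mul_one, mul_zero,
      sub_zero] at h2
    have h4 := congrArg (fun z : ℂ => ‖z‖ ^ 2) h2
    simp only [norm_mul, mul_pow, Complex.norm_natCast, norm_stdAddChar_sub_one, sq_abs] at h4
    rw [mul_one_div, eq_div_iff (pow_ne_zero _ hs)]
    linarith
  rw [Finset.sum_congr rfl h1, ← Finset.mul_sum, h0] at h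
  have h5 : (p : ℝ) ^ 2 / 4 *
      ∑ c ∈ Finset.univ.erase (0 : ZMod p), 1 / Real.sin (Real.pi / p * (c.val : ℝ)) ^ 2 =
      (p : ℝ) ^ 2 / 4 * (((p : ℝ) ^ 2 - 1) / 3) := by
    linear_combination h
  exact mul_left_cancel₀ (by positivity) h5

/-! ### Sums of `rho` over polynomials of bounded degree -/

theorem card_degreeLT (p : ℕ) [Fact p.Prime] (m : ℕ) :
    Fintype.card (degreeLT (ZMod p) m) = p ^ m := by
  rw [Fintype.card_congr (degreeLTEquiv (ZMod p) m).toEquiv]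
  simp [ZMod.card]

/-- Adding a term of degree `m` to a polynomial of degree less than `m`. -/
def addTop (p : ℕ) [Fact p.Prime] (m : ℕ) (x : ZMod p × degreeLT (ZMod p) m) :
    degreeLT (ZMod p) (m + 1) :=
  ⟨(x.2 : (ZMod p)[X]) + C x.1 * X ^ m, by
    rw [mem_degreeLT]
    refine (degree_add_le _ _).trans_lt (max_lt ?_ ?_)
    · exact (mem_degreeLT.mp x.2.2).trans (by exact_mod_cast Nat.lt_succ_self m)
    · exact (degree_C_mul_X_pow_le _ _).trans_lt (by exact_mod_cast Nat.lt_succ_self m)⟩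

theorem addTop_bijective (p : ℕ) [Fact p.Prime] (m : ℕ) : Function.Bijective (addTop p m) := by
  rw [Fintype.bijective_iff_injective_and_card]
  constructor
  · rintro ⟨c, h⟩ ⟨c', h'⟩ e
    have e1 : (h : (ZMod p)[X]) + C c * X ^ m = (h' : (ZMod p)[X]) + C c' * X ^ m := congrArg Subtype.val e
    have hc : c = c' := by
      have := congrArg (fun P : (ZMod p)[X] => P.coeff m) e1
      simpa [coeff_eq_zero_of_degree_lt (mem_degreeLT.mp h.2),
        coeff_eq_zero_of_degree_lt (mem_degreeLT.mp h'.2)] using this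
    subst hc
    rw [add_left_inj] at e1
    rw [Subtype.ext e1]
  · rw [Fintype.card_prod, card_degreeLT, card_degreeLT, ZMod.card, pow_succ']

theorem rho_addTop (p : ℕ) [Fact p.Prime] (m : ℕ) {c : ZMod p} (hc : c ≠ 0)
    (h : degreeLT (ZMod p) m) :
    (addTop p m (c, h) : (ZMod p)[X]) ≠ 0 ∧ rho p (addTop p m (c, h)) =
      1 / (p : ℝ) ^ (m + 1) * (1 / Real.sin (Real.pi / p * (c.val : ℝ)) ^ 2) := by
  have hlt : (h : (ZMod p)[X]).degree < (C c * X ^ m).degree := by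
    rw [degree_C_mul_X_pow _ hc]; exact mem_degreeLT.mp h.2
  have hd : (addTop p m (c, h) : (ZMod p)[X]).natDegree = m := by
    rw [addTop, natDegree_add_eq_right_of_degree_lt hlt, natDegree_C_mul_X_pow _ _ hc]
  have hl : (addTop p m (c, h) : (ZMod p)[X]).leadingCoeff = c := by
    rw [addTop, leadingCoeff_add_of_degree_lt hlt, leadingCoeff_C_mul_X_pow]
  refine ⟨fun h0 => hc (by rw [← hl, h0, leadingCoeff_zero]), ?_⟩
  rw [rho, hd, hl, one_div_mul_one_div]

-- Every degree `a < m` contributes the same amount: `p^a` polynomials for each leading coefficient,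
-- each weighted by `p^(-a-1)` times a squared cosecant.
open Classical in
theorem sum_rho (p : ℕ) [Fact p.Prime] (m : ℕ) :
    ∑ h : degreeLT (ZMod p) m, (if (h : (ZMod p)[X]) = 0 then 0 else rho p h) =
      m * ((p : ℝ) ^ 2 - 1) / (3 * p) := by
  have hp : (p : ℝ) ≠ 0 := by exact_mod_cast (Fact.out : p.Prime).ne_zero
  induction m with
  | zero =>
    rw [Finset.sum_eq_zero]
    · simp
    · intro h _
      refine if_pos ?_
      have := mem_degreeLT.mp h.2
      rwa [Nat.cast_zero, Nat.WithBot.lt_zero_iff, degree_eq_bot] at this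
  | succ m ih =>
    rw [← (addTop_bijective p m).sum_comp
      (fun h => if (h : (ZMod p)[X]) = 0 then 0 else rho p h), Fintype.sum_prod_type,
      ← Finset.add_sum_erase _ _ (Finset.mem_univ (0 : ZMod p))]
    have h0 : ∀ h, ((addTop p m (0, h)) : (ZMod p)[X]) = h := fun h => by simp [addTop]
    simp_rw [h0]
    rw [ih]
    have h1 : ∀ c ∈ Finset.univ.erase (0 : ZMod p), ∑ h : degreeLT (ZMod p) m,
        (if (addTop p m (c, h) : (ZMod p)[X]) = 0 then 0 else rho p (addTop p m (c, h))) =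
        1 / (p : ℝ) * (1 / Real.sin (Real.pi / p * (c.val : ℝ)) ^ 2) := by
      intro c hc
      have hr := fun h => rho_addTop p m (Finset.ne_of_mem_erase hc) h
      rw [Finset.sum_congr rfl fun h _ => by rw [if_neg (hr h).1, (hr h).2], Finset.sum_const,
        Finset.card_univ, card_degreeLT, nsmul_eq_mul, ← mul_assoc]
      congr 1
      rw [pow_succ]
      push_cast
      field_simp
    rw [Finset.sum_congr rfl h1, ← Finset.mul_sum, sum_one_div_sin_sq]
    push_cast
    field_simp

theorem sum_rhoW (p : ℕ) [Fact p.Prime] (m : ℕ) (γ : ℝ) :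
    ∑ h : degreeLT (ZMod p) m, rhoW p h γ = 1 + γ + γ * (m * ((p : ℝ) ^ 2 - 1) / (3 * p)) := by
  classical
  have h1 : ∀ h : degreeLT (ZMod p) m, rhoW p h γ =
      (if h = 0 then 1 + γ else 0) + γ * (if (h : (ZMod p)[X]) = 0 then 0 else rho p h) := by
    intro h
    by_cases h0 : h = 0
    · simp [rhoW, h0]
    · have h0' : (h : (ZMod p)[X]) ≠ 0 := by simpa using h0
      simp [rhoW, h0, h0']
  simp_rw [h1]
  rw [Finset.sum_add_distrib, ← Finset.mul_sum, sum_rho]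
  simp

/-! ### The component-by-component bound on `R` -/

open Classical in
/-- The part of `R` in dimension `d + 1` coming from vectors whose last entry is nonzero. -/
def lastPart (p : ℕ) [Fact p.Prime] (m : ℕ) {d : ℕ} (γ : Fin (d + 1) → ℝ)
    (v : Fin d → (ZMod p)[X]) (q f : (ZMod p)[X]) : ℝ :=
  ∑ a ∈ Finset.univ.erase (0 : degreeLT (ZMod p) m), rhoW p a (γ (Fin.last d)) *
    ∑ h : Fin d → degreeLT (ZMod p) m,
      if f ∣ ∑ i, (h i : (ZMod p)[X]) * v i + a * q then
        ∏ i, rhoW p (h i) (γ i.castSucc) else 0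

theorem R_snoc (p : ℕ) [Fact p.Prime] (m : ℕ) {d : ℕ} (γ : Fin (d + 1) → ℝ)
    (v : Fin d → (ZMod p)[X]) (q f : (ZMod p)[X]) :
    R p m γ (Fin.snoc (α := fun _ => (ZMod p)[X]) v q) f =
      (1 + γ (Fin.last d)) * R p m (fun i => γ i.castSucc) v f + lastPart p m γ v q f := by
  classical
  rw [R, Finset.sum_filter, ← (Fin.snocEquiv fun _ => degreeLT (ZMod p) m).sum_comp,
    Fintype.sum_prod_type, ← Finset.add_sum_erase _ _ (Finset.mem_univ 0)]
  have hs : ∀ (a : degreeLT (ZMod p) m) (h : Fin d → degreeLT (ZMod p) m),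
      (Fin.snocEquiv fun _ => degreeLT (ZMod p) m) (a, h) = 0 ↔ a = 0 ∧ h = 0 := by
    intro a h
    constructor
    · intro e
      refine ⟨by simpa using congrFun e (Fin.last d), ?_⟩
      ext1 i
      simpa using congrFun e i.castSucc
    · rintro ⟨rfl, rfl⟩
      ext1 i
      refine Fin.lastCases ?_ (fun i => ?_) i <;> simp
  congr 1
  · rw [R, Finset.sum_filter, Finset.mul_sum]
    refine Finset.sum_congr rfl fun h _ => ?_
    simp only [ne_eq, hs, true_and]
    simp only [Fin.snocEquiv_apply, Fin.sum_univ_castSucc, Fin.prod_univ_castSucc,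
      Fin.snoc_castSucc, Fin.snoc_last, ZeroMemClass.coe_zero, zero_mul, add_zero, mul_ite, mul_zero]
    refine if_congr Iff.rfl ?_ rfl
    rw [mul_comm, rhoW, if_pos rfl]
  · refine Finset.sum_congr rfl fun a ha => ?_
    rw [Finset.mul_sum]
    refine Finset.sum_congr rfl fun h _ => ?_
    have ha' : a ≠ 0 := Finset.ne_of_mem_erase ha
    simp only [ne_eq, hs, ha', false_and, not_false_eq_true, true_and]
    simp only [Fin.snocEquiv_apply, Fin.sum_univ_castSucc, Fin.prod_univ_castSucc,
      Fin.snoc_castSucc, Fin.snoc_last, mul_ite, mul_zero]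
    refine if_congr Iff.rfl ?_ rfl
    rw [mul_comm]

theorem sum_prod_rhoW (p : ℕ) [Fact p.Prime] (m : ℕ) {d : ℕ} (γ : Fin d → ℝ) :
    ∑ h : Fin d → degreeLT (ZMod p) m, ∏ i, rhoW p (h i) (γ i) =
      ∏ i, (1 + γ i + γ i * (m * ((p : ℝ) ^ 2 - 1) / (3 * p))) := by
  classical
  simp_rw [← sum_rhoW]
  rw [Finset.prod_univ_sum, Fintype.piFinset_univ]

theorem sum_erase_rhoW (p : ℕ) [Fact p.Prime] (m : ℕ) (γ : ℝ) [DecidableEq (degreeLT (ZMod p) m)] :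
    ∑ a ∈ Finset.univ.erase (0 : degreeLT (ZMod p) m), rhoW p a γ =
      γ * (m * ((p : ℝ) ^ 2 - 1) / (3 * p)) := by
  have h := sum_rhoW p m γ
  rw [← Finset.add_sum_erase _ _ (Finset.mem_univ 0)] at h
  have h0 : rhoW p ((0 : degreeLT (ZMod p) m) : (ZMod p)[X]) γ = 1 + γ := by simp [rhoW]
  rw [h0] at h
  linarith

/-- A bound for a sum of values of `lastPart` over a set of `q` such that each congruence has at
most one solution in that set. -/
theorem sum_lastPart_le (p : ℕ) [Fact p.Prime] (m : ℕ) {d : ℕ} (γ : Fin (d + 1) → ℝ)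
    (hγ : ∀ i, 0 ≤ γ i) (v : Fin d → (ZMod p)[X]) (f : (ZMod p)[X]) {ι : Type*} (S : Finset ι)
    (q : ι → (ZMod p)[X])
    (hS : ∀ a : degreeLT (ZMod p) m, a ≠ 0 → ∀ b : (ZMod p)[X], ∀ x ∈ S, ∀ y ∈ S,
      f ∣ b + a * q x → f ∣ b + a * q y → x = y) :
    ∑ x ∈ S, lastPart p m γ v (q x) f ≤
      γ (Fin.last d) * (m * ((p : ℝ) ^ 2 - 1) / (3 * p)) *
        ∏ i : Fin d, (1 + γ i.castSucc + γ i.castSucc * (m * ((p : ℝ) ^ 2 - 1) / (3 * p))) := by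
  classical
  simp only [lastPart]
  rw [Finset.sum_comm, ← sum_erase_rhoW, ← sum_prod_rhoW, Finset.sum_mul]
  refine le_of_le_of_eq (Finset.sum_le_sum fun a ha => ?_) (by congr!)
  rw [← Finset.mul_sum, Finset.sum_comm]
  refine mul_le_mul_of_nonneg_left (Finset.sum_le_sum fun h _ => ?_) (rhoW_nonneg p _ (hγ _))
  have hP : 0 ≤ ∏ i, rhoW p (h i) (γ i.castSucc) :=
    Finset.prod_nonneg fun i _ => rhoW_nonneg p _ (hγ _)
  rw [← Finset.sum_filter, Finset.sum_const, nsmul_eq_mul]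
  refine mul_le_of_le_one_left hP ?_
  have : (S.filter fun x => f ∣ ∑ i, (h i : (ZMod p)[X]) * v i + a * q x).card ≤ 1 := by
    refine Finset.card_le_one.mpr fun x hx y hy => ?_
    rw [Finset.mem_filter] at hx hy
    exact hS a (Finset.ne_of_mem_erase ha) _ x hx.1 y hy.1 hx.2 hy.2
  exact_mod_cast this

theorem not_dvd_of_degree_lt {p : ℕ} [Fact p.Prime] {m n : ℕ} {f a : (ZMod p)[X]}
    (hfm : f.natDegree = m) (ha : a ≠ 0) (hdeg : a.degree < n) (hnm : n ≤ m) : ¬ f ∣ a := fun h => by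
  have h1 := natDegree_le_of_dvd h ha
  have h2 := (natDegree_lt_iff_degree_lt ha).mpr hdeg
  omega

/-- If `f` divides a positive power of `X` it divides `X`, so `m ≤ 1`; then `w < m` forces `w = 0`.
-/
theorem not_dvd_X_pow {p : ℕ} [Fact p.Prime] {m w : ℕ} {f : (ZMod p)[X]} (hf : Irreducible f)
    (hfm : f.natDegree = m) (hw : w < m) : ¬ f ∣ X ^ w := fun h => by
  rcases Nat.eq_zero_or_pos w with rfl | hw0
  · rw [pow_zero] at h
    exact hf.not_isUnit (isUnit_of_dvd_one h)
  · have h1 := natDegree_le_of_dvd (hf.prime.dvd_of_dvd_pow h) X_ne_zero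
    rw [natDegree_X] at h1
    omega

/-- The minimum is compared with the sum over all nonzero polynomials of degree `< m - w`, which are
automatically coprime to `f`. Two solutions `x ≠ y` of one congruence would give `f ∣ a X^w (x -
y)`, impossible for a prime `f` of degree `m`. -/
theorem card_search_mul_lastPart_le (p : ℕ) [Fact p.Prime] {m w : ℕ} (hw : w < m) {d : ℕ}
    (γ : Fin (d + 1) → ℝ) (hγ : ∀ i, 0 ≤ γ i) (v : Fin d → (ZMod p)[X]) {f g : (ZMod p)[X]}
    (hf : Irreducible f) (hfm : f.natDegree = m)
    (hmin : ∀ q ∈ searchSet p m w f,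
      lastPart p m γ v (X ^ w * g) f ≤ lastPart p m γ v (X ^ w * q) f) :
    ((p : ℝ) ^ (m - w) - 1) * lastPart p m γ v (X ^ w * g) f ≤
      γ (Fin.last d) * (m * ((p : ℝ) ^ 2 - 1) / (3 * p)) *
        ∏ i : Fin d, (1 + γ i.castSucc + γ i.castSucc * (m * ((p : ℝ) ^ 2 - 1) / (3 * p))) := by
  classical
  have hsum := sum_lastPart_le p m γ hγ v f
    (Finset.univ.erase (0 : degreeLT (ZMod p) (m - w))) (fun q => X ^ w * (q : (ZMod p)[X])) (by
      intro a ha b x _ y _ hx hy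
      by_contra hxy
      have h1 := dvd_sub hx hy
      rw [add_sub_add_left_eq_sub, ← mul_sub, ← mul_sub] at h1
      have ha' : (a : (ZMod p)[X]) ≠ 0 := by simpa using ha
      have hxy' : ((x - y : degreeLT (ZMod p) (m - w)) : (ZMod p)[X]) ≠ 0 := by
        simpa [sub_eq_zero] using hxy
      rcases hf.prime.dvd_or_dvd h1 with h2 | h2
      · exact not_dvd_of_degree_lt hfm ha' (mem_degreeLT.mp a.2) le_rfl h2
      rcases hf.prime.dvd_or_dvd h2 with h3 | h3
      · exact not_dvd_X_pow hf hfm hw h3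
      · exact not_dvd_of_degree_lt hfm hxy' (mem_degreeLT.mp (x - y).2) (Nat.sub_le _ _) h3)
  refine le_trans ?_ hsum
  have hcard : ((Finset.univ.erase (0 : degreeLT (ZMod p) (m - w))).card : ℝ) =
      (p : ℝ) ^ (m - w) - 1 := by
    rw [Finset.card_erase_of_mem (Finset.mem_univ _), Finset.card_univ, card_degreeLT,
      Nat.cast_sub (Nat.one_le_pow _ _ (Fact.out : p.Prime).pos)]
    push_cast; rfl
  rw [← hcard, ← nsmul_eq_mul]
  refine Finset.card_nsmul_le_sum _ _ _ fun q hq => hmin q ?_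
  rw [searchSet, if_pos hw]
  have hq0 : (q : (ZMod p)[X]) ≠ 0 := by simpa using Finset.ne_of_mem_erase hq
  exact ⟨mem_degreeLT.mp q.2, ((hf.coprime_iff_not_dvd).mpr
    (not_dvd_of_degree_lt hfm hq0 (mem_degreeLT.mp q.2) (Nat.sub_le _ _))).symm⟩

theorem lastPart_le (p : ℕ) [Fact p.Prime] {m w d : ℕ} (γ : Fin (d + 1) → ℝ) (hγ : ∀ i, 0 ≤ γ i)
    (v : Fin d → (ZMod p)[X]) {f g : (ZMod p)[X]} (hf : Irreducible f) (hfm : f.natDegree = m)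
    (hmin : d ≠ 0 → ∀ q ∈ searchSet p m w f,
      lastPart p m γ v (X ^ w * g) f ≤ lastPart p m γ v (X ^ w * q) f)
    (hfirst : d = 0 → g = 1) :
    lastPart p m γ v (X ^ w * g) f ≤ 1 / (p : ℝ) ^ m *
      (γ (Fin.last d) * (p : ℝ) ^ min w m * m * (((p : ℝ) + 1) / 3)) *
        ∏ i : Fin d, (1 + γ i.castSucc + γ i.castSucc * (m * ((p : ℝ) ^ 2 - 1) / (3 * p))) := by
  classical
  have hp2 : (2 : ℝ) ≤ p := by exact_mod_cast (Fact.out : p.Prime).two_le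
  have hp0 : (0 : ℝ) < p := by linarith
  have hK0 : 0 ≤ (m : ℝ) * ((p : ℝ) ^ 2 - 1) / (3 * p) :=
    div_nonneg (mul_nonneg (Nat.cast_nonneg _) (by nlinarith)) (by linarith)
  set W := ∏ i : Fin d, (1 + γ i.castSucc + γ i.castSucc * (m * ((p : ℝ) ^ 2 - 1) / (3 * p)))
    with hW
  have hW0 : 0 ≤ W := Finset.prod_nonneg fun i _ => by
    have := mul_nonneg (hγ i.castSucc) hK0
    have := hγ i.castSucc
    linarith
  have hγl := hγ (Fin.last d)
  rcases le_or_gt m w with hmw | hwm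
  · have h1 := sum_lastPart_le p m γ hγ v f {()} (fun _ => X ^ w * g) (by simp)
    rw [Finset.sum_singleton] at h1
    refine h1.trans (mul_le_mul_of_nonneg_right ?_ hW0)
    rw [min_eq_right hmw]
    have e : 1 / (p : ℝ) ^ m * (γ (Fin.last d) * (p : ℝ) ^ m * m * (((p : ℝ) + 1) / 3)) =
        γ (Fin.last d) * (m * (((p : ℝ) + 1) * p) / (3 * p)) := by field_simp
    rw [e]
    gcongr
    nlinarith
  · rw [min_eq_left hwm.le]
    by_cases hd : d = 0
    · have h0 : lastPart p m γ v (X ^ w * g) f = 0 := by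
        subst hd
        rw [hfirst rfl, mul_one, lastPart]
        refine Finset.sum_eq_zero fun a ha => ?_
        have ha' : (a : (ZMod p)[X]) ≠ 0 := by simpa using Finset.ne_of_mem_erase ha
        refine mul_eq_zero_of_right _ (Finset.sum_eq_zero fun h _ => if_neg fun h1 => ?_)
        rw [Finset.univ_eq_empty, Finset.sum_empty, zero_add] at h1
        rcases hf.prime.dvd_or_dvd h1 with h2 | h2
        · exact not_dvd_of_degree_lt hfm ha' (mem_degreeLT.mp a.2) le_rfl h2
        · exact not_dvd_X_pow hf hfm hwm h2
      rw [h0]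
      positivity
    · have h1 := card_search_mul_lastPart_le p hwm γ hγ v hf hfm (hmin hd)
      rw [← hW] at h1
      have hP : (p : ℝ) ≤ (p : ℝ) ^ (m - w) := le_self_pow₀ (by linarith) (by omega)
      have e : (p : ℝ) ^ m = (p : ℝ) ^ w * (p : ℝ) ^ (m - w) := by rw [← pow_add]; congr 1; omega
      set P := (p : ℝ) ^ (m - w) with hPdef
      have hP1 : 0 < P - 1 := by linarith
      have hP0 : 0 < P := by linarith
      rw [mul_comm (P - 1), ← le_div_iff₀ hP1] at h1
      refine h1.trans ?_
      rw [mul_div_right_comm]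
      refine mul_le_mul_of_nonneg_right ?_ hW0
      have e2 : 1 / (p : ℝ) ^ m * (γ (Fin.last d) * (p : ℝ) ^ w * m * (((p : ℝ) + 1) / 3)) =
          γ (Fin.last d) * m * ((p : ℝ) + 1) / 3 * (1 / P) := by
        rw [e]; field_simp
      have e3 : γ (Fin.last d) * (m * ((p : ℝ) ^ 2 - 1) / (3 * p)) / (P - 1) =
          γ (Fin.last d) * m * ((p : ℝ) + 1) / 3 * ((p - 1) / (p * (P - 1))) := by
        field_simp; ring
      rw [e2, e3]
      -- What remains is `(p - 1) P ≤ p (P - 1)`, that is, `p ≤ P`.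
      refine mul_le_mul_of_nonneg_left ?_ (by positivity)
      rw [div_le_div_iff₀ (by positivity) hP0]
      nlinarith

theorem R_le_of_isReducedCBC (p : ℕ) [Fact p.Prime] {m s : ℕ} (γ : ℕ → ℝ) (hγ : ∀ j, 0 ≤ γ j)
    (w : ℕ → ℕ) {f : (ZMod p)[X]} (hf : Irreducible f) (hfm : f.natDegree = m)
    {g : Fin s → (ZMod p)[X]} (hg : IsReducedCBC p m γ w f g) (d : ℕ) (hd : d ≤ s) :
    R p m (fun i : Fin d => γ i.val) (fun i : Fin d => X ^ w i.val * g (i.castLE hd)) f ≤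
      1 / (p : ℝ) ^ m * ∏ i : Fin d, (1 + γ i.val +
        γ i.val * (p : ℝ) ^ min (w i.val) m * (m : ℝ) * (((p : ℝ) + 1) / 3)) := by
  have hp2 : (2 : ℝ) ≤ p := by exact_mod_cast (Fact.out : p.Prime).two_le
  have hK0 : 0 ≤ (m : ℝ) * ((p : ℝ) ^ 2 - 1) / (3 * p) :=
    div_nonneg (mul_nonneg (Nat.cast_nonneg _) (by nlinarith)) (by linarith)
  induction d with
  | zero =>
    unfold R
    refine le_of_eq_of_le (Finset.sum_eq_zero ?_) (by positivity)
    intro h hh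
    simp only [Finset.mem_filter] at hh
    exact absurd (Subsingleton.elim h 0) hh.2.1
  | succ d ih =>
    have ih := ih (Nat.le_of_succ_le hd)
    set v : Fin d → (ZMod p)[X] :=
      fun i => X ^ w i.val * g (i.castLE (Nat.le_of_succ_le hd)) with hv
    set D : Fin s := ⟨d, hd⟩ with hD
    have hext : ∀ q, extendBy w g D q =
        Fin.snoc (α := fun _ => (ZMod p)[X]) v (X ^ w d * q) := fun q => rfl
    have hvec : (fun i : Fin (d + 1) => X ^ w i.val * g (i.castLE hd)) =
        Fin.snoc (α := fun _ => (ZMod p)[X]) v (X ^ w d * g D) := by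
      ext1 i
      refine Fin.lastCases ?_ (fun i => ?_) i
      · rw [Fin.snoc_last]; rfl
      · rw [Fin.snoc_castSucc]; rfl
    have hlast := lastPart_le p (w := w d) (fun i : Fin (d + 1) => γ i.val) (fun i => hγ _) v
      (g := g D) hf hfm (fun hd0 q hq => by
        have := hg.step D hd0 q hq
        rw [hext, hext] at this
        erw [R_snoc, R_snoc] at this
        linarith) (fun hd0 => hg.first D hd0)
    rw [hvec, R_snoc, Fin.prod_univ_castSucc]
    simp only [Fin.val_castSucc, Fin.val_last] at hlast ⊢
    set Q := ∏ i : Fin d, (1 + γ i.val +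
        γ i.val * (p : ℝ) ^ min (w i.val) m * (m : ℝ) * (((p : ℝ) + 1) / 3))
    -- Averaging gives the smaller factors with `m (p² - 1) / (3p)`; enlarging them to those of `Q`
    -- lets both contributions combine into one new factor.
    have hWQ : ∏ i : Fin d, (1 + γ i.val + γ i.val * (m * ((p : ℝ) ^ 2 - 1) / (3 * p))) ≤ Q := by
      refine Finset.prod_le_prod (fun i _ => ?_) fun i _ => ?_
      · have := mul_nonneg (hγ i.val) hK0
        have := hγ i.val
        linarith
      · have h1 : (m : ℝ) * ((p : ℝ) ^ 2 - 1) / (3 * p) ≤ m * (((p : ℝ) + 1) / 3) := by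
          rw [div_le_iff₀ (by linarith)]
          have : (m : ℝ) * ((p : ℝ) ^ 2 - 1) ≤ m * (((p : ℝ) + 1) * p) := by
            gcongr; nlinarith
          linarith
        have h2 : (1 : ℝ) ≤ (p : ℝ) ^ min (w i.val) m := one_le_pow₀ (by linarith)
        have h3 : (m : ℝ) * (((p : ℝ) + 1) / 3) ≤
            (p : ℝ) ^ min (w i.val) m * (m * (((p : ℝ) + 1) / 3)) :=
          le_mul_of_one_le_left (by positivity) h2
        have h4 := mul_le_mul_of_nonneg_left (h1.trans h3) (hγ i.val)
        linarith
    have hγd := hγ d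
    calc _ ≤ (1 + γ d) * (1 / (p : ℝ) ^ m * Q) + 1 / (p : ℝ) ^ m *
          (γ d * (p : ℝ) ^ min (w d) m * m * (((p : ℝ) + 1) / 3)) * Q := by
          refine add_le_add (mul_le_mul_of_nonneg_left ih (by linarith)) (hlast.trans ?_)
          exact mul_le_mul_of_nonneg_left hWQ (by positivity)
      _ = _ := by ring

end PolyLattice

end

theorem mainTheorem5 (p : ℕ) [Fact p.Prime] (m s : ℕ) (hs : 1 ≤ s)
    (γ : ℕ → ℝ) (hγ_pos : ∀ j, 0 < γ j) (hγ_le : ∀ j, γ j ≤ 1) (hγ_anti : Antitone γ)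
    (w : ℕ → ℕ) (hw : Monotone w)
    (f : (ZMod p)[X]) (hf : Irreducible f) (hfm : f.natDegree = m)
    (g : Fin s → (ZMod p)[X]) (hg : PolyLattice.IsReducedCBC p m γ w f g)
    (N : ℕ) (hN : N = p ^ m) :
    PolyLattice.weightedStarDisc (PolyLattice.prodWeight fun i : Fin s => γ i.val)
        (PolyLattice.latticePoint p m (fun i : Fin s => X ^ w i.val * g i) f) ≤
      (∑ u : Finset (Fin s) with u.Nonempty,
          PolyLattice.prodWeight (fun i : Fin s => γ i.val) u *
            (1 - (1 - 1 / (N : ℝ)) ^ u.card)) +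
        1 / (N : ℝ) *
          ∏ i : Fin s, (1 + γ i.val +
            γ i.val * (p : ℝ) ^ min (w i.val) m * (m : ℝ) * (((p : ℝ) + 1) / 3)) := by
  subst hN
  have h1 := PolyLattice.weightedStarDisc_le_add_R p m hf.ne_zero hfm
    (fun i : Fin s => X ^ w i.val * g i) (fun i : Fin s => γ i.val) fun i => (hγ_pos _).le
  have h2 := PolyLattice.R_le_of_isReducedCBC p γ (fun j => (hγ_pos j).le) w hf hfm hg s le_rfl
  push_cast
  exact h1.trans (add_le_add_right h2 _)
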